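/- Let $\mathbb K\in\{\mathbb R,\mathbb C\}$, let $\mathcal A$ be a (non-empty) directed set, and let $(X_\alpha,d_\alpha,m_\alpha)_{\alpha\in\mathcal A}$ be a net of compact metric spaces with finite Borel measures converging to such a space $(X_\infty,d_\infty,m_\infty)$ in the measured Gromov–Hausdorff topology. That is, there are $\varepsilon_\alpha>0$ with $\varepsilon_\alpha\to0$ and $m_\alpha$-measurable maps $f_\alpha:X_\alpha\to X_\infty$ such that the $\varepsilon_\alpha$-neighbourhood of $f_\alpha(X_\alpha)$ is $X_\infty$, $|d_\alpha(x,y)-d_\infty(f_\alpha(x),f_\alpha(y))|\le\varepsilon_\alpha$ for all $x,y\in X_\alpha$, and $\int g\circ f_\alpha\,dm_\alpha\to\int g\,dm_\infty$ for all continuous $g:X_\infty\to\mathbb R$. Fix such maps $f_\alpha$ and write $L^2_\alpha=L^2(X_\alpha,m_\alpha;\mathbb K)$, $L^2_\infty=L^2(X_\infty,m_\infty;\mathbb K)$. *Convergence of vectors and operators.* A net $u_\alpha\in L^2_\alpha$ converges strongly to $u\in L^2_\infty$ if there is a net $(v_\beta)$ of continuous functions on $X_\infty$ with $v_\beta\to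 u$ in $L^2_\infty$ and $\lim_\beta\limsup_\alpha\|v_\beta\circ f_\alpha-u_\alpha\|_{L^2_\alpha}=0$. It converges weakly to $u$ if $\langle u_\alpha,v_\alpha\rangle\to\langle u,v\rangle$ whenever $v_\alpha\in L^2_\alpha$ converges strongly to $v\in L^2_\infty$. Bounded operators $B_\alpha$ on $L^2_\alpha$ converge compactly to a bounded operator $B$ on $L^2_\infty$ if $B_\alpha u_\alpha\to Bu$ strongly whenever $u_\alpha\to u$ weakly. *Spectral structures.* A spectral structure $\Sigma$ on a Hilbert space is a non-negative self-adjoint (possibly unbounded) operator $A$, together with its quadratic form, spectral measure, semigroup $e^{-tA}$ and resolvent $R_\zeta=(\zeta-A)^{-1}$, $\zeta\in\rho(A)$. Let $\Sigma_\alpha$ (operator $A_\alpha$, resolvent $R^\alpha_\zeta$) be spectral structures on $L^2_\alpha$ and $\Sigma$ (operator $A$, resolvent $R_\zeta$) one on $L^2_\infty$. We say that $\Sigma_\alpha\to\Sigma$ compactly if $R^\alpha_\zeta\to R_\zeta$ compactly for every $\zeta\in\mathbb K$ outside the union of the spectra of $A$ and of all the $A_\alpha$. **Theorem.** Suppose that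 $\Sigma_\alpha\to\Sigma$ compactly and that all the resolvents $R^\alpha_\zeta$ ($\alpha\in\mathcal A$, $\zeta\in\rho(A_\alpha)$) are compact operators. For $k\ge1$ let $\lambda_k$ (resp. $\lambda_k^\alpha$) be the $k$-th eigenvalue of $A$ (resp. $A_\alpha$), in increasing order and counted with multiplicity, with the value $+\infty$ if $k>\dim L^2_\infty$ (resp. $k>\dim L^2_\alpha$). Then for every $k\ge1$ $$\lim_\alpha\lambda_k^\alpha=\lambda_k\quad\text{in }[0,+\infty].$$ Furthermore, for every $\alpha$ let $\{\varphi_k^\alpha\mid 1\le k\le\dim L^2_\alpha\}$ ($k=1,2,\dots$ if the dimension is infinite) be an orthonormal basis of $L^2_\alpha$ such that $\varphi^\alpha_k$ is an eigenvector of $A_\alpha$ for $\lambda_k^\alpha$. Then there are a subnet of $\mathcal A$, the same for all $k$, and an orthonormal basis $\{\varphi_k\mid 1\le k\le\dim L^2_\infty\}$ of $L^2_\infty$ such that $\varphi_k$ is an eigenvector of $A$ for $\lambda_k$ and, for every $k\le\dim L^2_\infty$, the net $(\varphi_k^\alpha)_\alpha$ converges strongly to $\varphi_k$ along the subnet ($\varphi_k^\alpha$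 being defined for all large enough indices). -/

import Mathlib

open MeasureTheory Filter Topology
open scoped ENNReal

universe u

noncomputable section

namespace SpectralConvergence

/-! ### Measured Gromov-Hausdorff convergence of a net of compact metric measure spaces -/

/-- `φ : X → Y` is an `ε`-Hausdorff approximation: the `ε`-neighbourhood of its image is `Y`, and
it changes distances by at most `ε`. -/
def IsHausdorffApprox {X Y : Type*} [MetricSpace X] [MetricSpace Y] (ε : ℝ) (φ : X → Y) : Prop :=
  Metric.thickening ε (Set.range φ) = Set.univ ∧
    ∀ x y : X, |dist x y - dist (φ x) (φ y)| ≤ ε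

/-- The net `(X α, m α)` converges to `(Y, m₀)` for the measured Gromov-Hausdorff topology,
by means of the approximations `f α : X α → Y`. -/
def MeasuredGHConverges {ι : Type*} [Preorder ι] {X : ι → Type*} [∀ α, MetricSpace (X α)]
    [∀ α, MeasurableSpace (X α)] {Y : Type*} [MetricSpace Y] [MeasurableSpace Y]
    (m : ∀ α, Measure (X α)) (m₀ : Measure Y) (f : ∀ α, X α → Y) : Prop :=
  (∃ ε : ι → ℝ, (∀ α, 0 < ε α) ∧ Tendsto ε atTop (𝓝 0) ∧ ∀ α, IsHausdorffApprox (ε α) (f α)) ∧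
  (∀ α, AEMeasurable (f α) (m α)) ∧
  ∀ g : C(Y, ℝ), Tendsto (fun α => ∫ x, g (f α x) ∂(m α)) atTop (𝓝 (∫ y, g y ∂m₀))

/-! ### Convergence of vectors and of bounded operators along the spaces `L²(X α)` -/

section Nets

variable {𝕜 : Type*} [RCLike 𝕜] {ι : Type*} [Preorder ι] {X : ι → Type*}
  [∀ α, MeasurableSpace (X α)] {Y : Type*} [TopologicalSpace Y] [MeasurableSpace Y]
  {m : ∀ α, Measure (X α)} {m₀ : Measure Y}

/-- Strong convergence of `u α ∈ L²(X α)` to `w ∈ L²(Y)`: there is a net `v β` of continuous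
functions on `Y` with `v β → w` in `L²(Y)` and
`lim_β limsup_α ‖v β ∘ f α - u α‖_{L²(X α)} = 0`. -/
def StronglyConverges (f : ∀ α, X α → Y) (u : ∀ α, Lp 𝕜 2 (m α)) (w : Lp 𝕜 2 m₀) : Prop :=
  ∃ (κ : Type) (_ : Preorder κ) (_ : IsDirectedOrder κ) (_ : Nonempty κ) (v : κ → C(Y, 𝕜)),
    Tendsto (fun β => eLpNorm (fun y => v β y - w y) 2 m₀) atTop (𝓝 0) ∧
    Tendsto (fun β => limsup (fun α => eLpNorm (fun x => v β (f α x) - u α x) 2 (m α)) atTop)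
      atTop (𝓝 (0 : ℝ≥0∞))

/-- Weak convergence of `u α ∈ L²(X α)` to `w ∈ L²(Y)`: the scalar products with every strongly
convergent net converge. -/
def WeaklyConverges (f : ∀ α, X α → Y) (u : ∀ α, Lp 𝕜 2 (m α)) (w : Lp 𝕜 2 m₀) : Prop :=
  ∀ (v : ∀ α, Lp 𝕜 2 (m α)) (z : Lp 𝕜 2 m₀), StronglyConverges f v z →
    Tendsto (fun α => inner 𝕜 (u α) (v α)) atTop (𝓝 (inner 𝕜 w z))

/-- Compact convergence of bounded operators: weakly convergent nets are mapped to strongly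
convergent ones. -/
def CompactlyConverges (f : ∀ α, X α → Y) (B : ∀ α, Lp 𝕜 2 (m α) →L[𝕜] Lp 𝕜 2 (m α))
    (B₀ : Lp 𝕜 2 m₀ →L[𝕜] Lp 𝕜 2 m₀) : Prop :=
  ∀ (u : ∀ α, Lp 𝕜 2 (m α)) (w : Lp 𝕜 2 m₀), WeaklyConverges f u w →
    StronglyConverges f (fun α => B α (u α)) (B₀ w)

end Nets

/-! ### Spectral structures, resolvents and eigenvalues -/

section Operators

variable {𝕜 : Type*} [RCLike 𝕜] {H : Type*} [NormedAddCommGroup H] [InnerProductSpace 𝕜 H]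

/-- A spectral structure on a Hilbert space is given by a non-negative self-adjoint operator `A`,
possibly unbounded (self-adjointness includes the density of the domain). The closed quadratic
form `u ↦ ‖√A u‖²`, the spectral measure, the semigroup `exp (-t A)` and the resolvent of the
structure are those of `A`. -/
structure SpectralStructure (𝕜 : Type*) [RCLike 𝕜] (H : Type*) [NormedAddCommGroup H]
    [InnerProductSpace 𝕜 H] [CompleteSpace H] where
  /-- the operator -/
  A : H →ₗ.[𝕜] H
  selfAdjoint : IsSelfAdjoint A
  nonneg : ∀ x : A.domain, 0 ≤ RCLike.re (inner 𝕜 (A x) (x : H))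

/-- The bounded operator `R` is a two-sided inverse `(ζ - A)⁻¹ : H → D(A)`. -/
def IsResolventAt (A : H →ₗ.[𝕜] H) (ζ : 𝕜) (R : H →L[𝕜] H) : Prop :=
  (∀ u : H, ∃ h : R u ∈ A.domain, ζ • R u - A ⟨R u, h⟩ = u) ∧
    ∀ x : A.domain, R (ζ • (x : H) - A x) = x

/-- The resolvent set `ρ(A)`, the complement of the spectrum. -/
def resolventSet (A : H →ₗ.[𝕜] H) : Set 𝕜 := {ζ | ∃ R : H →L[𝕜] H, IsResolventAt A ζ R}

open Classical in
/-- The resolvent `R_ζ = (ζ - A)⁻¹` for `ζ ∈ ρ(A)` (and `0` for `ζ ∉ ρ(A)`). -/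
def resolvent (A : H →ₗ.[𝕜] H) (ζ : 𝕜) : H →L[𝕜] H :=
  if h : ∃ R : H →L[𝕜] H, IsResolventAt A ζ R then h.choose else 0

/-- `{x ∈ D(A) | A x = t x}`, as the set of `x` for which `(x, t x)` is in the graph of `A`. -/
def eigenspace (A : H →ₗ.[𝕜] H) (t : ℝ) : Submodule 𝕜 H :=
  A.graph.comap (LinearMap.id.prod ((t : 𝕜) • LinearMap.id))

/-- The `k`-th eigenvalue of `A` for `k = 1, 2, …`, in increasing order and counted with
multiplicity: the least `t` such that the eigenspaces for eigenvalues `≤ t` together have dimension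
at least `k`. It is `+∞` if `A` has fewer than `k` eigenvalues. -/
def kthEigenvalue (A : H →ₗ.[𝕜] H) (k : ℕ) : EReal :=
  sInf {s : EReal | ∃ t : ℝ, s = (t : EReal) ∧
    (k : Cardinal) ≤ Module.rank 𝕜 ↥(⨆ r : ℝ, ⨆ _ : r ≤ t, eigenspace A r)}

/-- The index set `{k | 1 ≤ k ≤ dim H}`; it is `{1, 2, …}` if `H` has infinite dimension. -/
def dimIndices (𝕜 : Type*) [RCLike 𝕜] (H : Type*) [NormedAddCommGroup H]
    [InnerProductSpace 𝕜 H] : Set ℕ :=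
  {k | 1 ≤ k ∧ (k : Cardinal) ≤ Module.rank 𝕜 H}

/-- `φ k`, for `1 ≤ k ≤ dim H`, is an orthonormal (Hilbert) basis of `H`, and `φ k` is an
eigenvector of `A` for its `k`-th eigenvalue. Nothing is said about `φ k` for other `k`. -/
def IsOrthonormalEigenbasis (A : H →ₗ.[𝕜] H) (φ : ℕ → H) : Prop :=
  Orthonormal 𝕜 (fun k : dimIndices 𝕜 H => φ k) ∧
  (Submodule.span 𝕜 (φ '' dimIndices 𝕜 H)).topologicalClosure = ⊤ ∧
  ∀ k ∈ dimIndices 𝕜 H, ∃ t : ℝ, kthEigenvalue A k = (t : EReal) ∧ φ k ∈ eigenspace A t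

end Operators

/-- Compact convergence of spectral structures: for every `ζ` outside the spectra of the limit
operator and of all the operators of the net, the resolvents at `ζ` converge compactly. -/
def SpectralStructure.CompactlyConverges {𝕜 : Type*} [RCLike 𝕜] {ι : Type*} [Preorder ι]
    {X : ι → Type*} [∀ α, MeasurableSpace (X α)] {Y : Type*} [TopologicalSpace Y]
    [MeasurableSpace Y] {m : ∀ α, Measure (X α)} {m₀ : Measure Y} (f : ∀ α, X α → Y)
    (S : ∀ α, SpectralStructure 𝕜 (Lp 𝕜 2 (m α))) (S₀ : SpectralStructure 𝕜 (Lp 𝕜 2 m₀)) : Prop :=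
  ∀ ζ : 𝕜, ζ ∈ resolventSet S₀.A → (∀ α, ζ ∈ resolventSet (S α).A) →
    SpectralConvergence.CompactlyConverges f (fun α => resolvent (S α).A ζ) (resolvent S₀.A ζ)

end SpectralConvergence

end

/-!
Since continuous functions are dense in `L²(Y)`, the maps `v ↦ v ∘ f α` can be replaced by
contractions `T α : L²(Y) → L²(X α)` that become isometric in the limit and satisfy
`v ∘ f α - T α v → 0` for every continuous `v`. Strong convergence `u α → w` then means
`‖u α - T α w‖ → 0`. Let `R α = (1 + A α)⁻¹` and `R₀ = (1 + A)⁻¹`. Compact convergence of the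
resolvents forces `R₀` to be compact and `‖R α - T α R₀ (T α)†‖ → 0`, because a family of unit
vectors on which the difference stays large would have a part converging weakly to `0`.

If this norm is small, then `T α` maps the span of the eigenvectors of `A` with eigenvalue `≤ a`
injectively to that of `A α` with eigenvalue `≤ b`, for `b > a`, and conversely for `(T α)†`; this
compares the dimensions, hence the eigenvalues. As for the eigenvectors, `R₀ (T α)† φ α k` lies in
a compact set, so it converges along an ultrafilter, and with it `φ α k = (1 + λ α k) R α φ α k`.
-/

noncomputable section

namespace SpectralConvergence

open ContinuousLinearMap InnerProductSpace

section Diagonal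

variable {ι : Type*} {F : Filter ι}

theorem exists_tendsto_atTop_diagonal {M : ι → ℕ} (hM : Tendsto M F atTop) {a : ℕ → ι → ℝ}
    (ha : ∀ n, Tendsto (a n) F (𝓝 0)) :
    ∃ n : ι → ℕ, Tendsto n F atTop ∧ Tendsto (fun α => a (n α) α) F (𝓝 0) := by
  classical
  let n : ι → ℕ := fun α => Nat.findGreatest (fun k => |a k α| < 1 / ((k : ℝ) + 1)) (M α)
  have hn : Tendsto n F atTop := by
    refine tendsto_atTop.2 fun N => ?_
    filter_upwards [hM.eventually_ge_atTop N,
      (ha N).abs.eventually_lt_const (abs_zero.trans_lt N.one_div_pos_of_nat)] with α hMN haN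
    exact Nat.le_findGreatest hMN haN
  refine ⟨n, hn, squeeze_zero_norm' ?_ (tendsto_one_div_add_atTop_nhds_zero_nat.comp hn)⟩
  filter_upwards [hn.eventually_ne_atTop 0] with α hα
  exact (Nat.findGreatest_of_ne_zero rfl hα).le

end Diagonal

section RankOneSum

variable {𝕜 : Type*} [RCLike 𝕜] {H : Type*} [NormedAddCommGroup H] [InnerProductSpace 𝕜 H]
  {E : Type*} [NormedAddCommGroup E] [InnerProductSpace 𝕜 E]
  {G : Type*} [NormedAddCommGroup G] [InnerProductSpace 𝕜 G]

variable (𝕜) in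
/-- The finite rank operator `z ↦ ∑ l < n, ⟪e l, z⟫ s l`. -/
def rankOneSum (s : ℕ → E) (e : ℕ → H) (n : ℕ) : H →L[𝕜] E :=
  ∑ l ∈ Finset.range n, rankOne 𝕜 (s l) (e l)

theorem rankOneSum_apply (s : ℕ → E) (e : ℕ → H) (n : ℕ) (z : H) :
    rankOneSum 𝕜 s e n z = ∑ l ∈ Finset.range n, inner 𝕜 (e l) z • s l := by
  simp [rankOneSum]

theorem comp_rankOneSum (K : E →L[𝕜] G) (s : ℕ → E) (e : ℕ → H) (n : ℕ) :
    K ∘L rankOneSum 𝕜 s e n = rankOneSum 𝕜 (fun l => K (s l)) e n := by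
  ext z
  simp [rankOneSum_apply]

theorem rankOneSum_sub (s t : ℕ → E) (e : ℕ → H) (n : ℕ) :
    rankOneSum 𝕜 s e n - rankOneSum 𝕜 t e n = rankOneSum 𝕜 (fun l => s l - t l) e n := by
  simp [rankOneSum, Finset.sum_sub_distrib]

theorem adjoint_rankOneSum [CompleteSpace H] [CompleteSpace E] (s : ℕ → E) (e : ℕ → H) (n : ℕ) :
    adjoint (rankOneSum 𝕜 s e n) = rankOneSum 𝕜 e s n := by
  simp [rankOneSum, map_sum]

theorem norm_rankOneSum_le (s : ℕ → E) {e : ℕ → H} (he : ∀ l, ‖e l‖ ≤ 1) (n : ℕ) :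
    ‖rankOneSum 𝕜 s e n‖ ≤ ∑ l ∈ Finset.range n, ‖s l‖ :=
  norm_sum_le_of_le _ fun l _ => by
    rw [norm_rankOne]
    exact mul_le_of_le_one_right (norm_nonneg _) (he l)

theorem isCompactOperator_rankOneSum (s : ℕ → E) (e : ℕ → H) (n : ℕ) :
    IsCompactOperator (rankOneSum 𝕜 s e n) := by
  induction n with
  | zero => simpa [rankOneSum] using isCompactOperator_zero
  | succ n ih =>
    rw [rankOneSum, Finset.sum_range_succ]
    exact ih.add ((isCompactOperator_of_locallyCompactSpace_rng
      (toSpanSingleton 𝕜 (s n))).comp_clm (innerSL 𝕜 (e n)))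

end RankOneSum

section PaddedBasis

variable {𝕜 : Type*} [RCLike 𝕜] {H : Type*} [NormedAddCommGroup H] [InnerProductSpace 𝕜 H]

variable (𝕜) in
/-- A Hilbert basis of a separable space, enumerated by `ℕ` with zero vectors allowed in between,
so that finite and infinite dimensions are treated alike. -/
structure IsPaddedHilbertBasis (e : ℕ → H) : Prop where
  orthogonal : Pairwise fun i j => inner 𝕜 (e i) (e j) = 0
  norm_eq_one_of_ne_zero : ∀ l, e l ≠ 0 → ‖e l‖ = 1
  dense_span : (Submodule.span 𝕜 (Set.range e)).topologicalClosure = ⊤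

theorem isPaddedHilbertBasis_gramSchmidtNormed {d : ℕ → H} (hd : DenseRange d) :
    IsPaddedHilbertBasis 𝕜 (gramSchmidtNormed 𝕜 d) where
  orthogonal i j hij := by
    simp [gramSchmidtNormed, inner_smul_left, inner_smul_right, gramSchmidt_orthogonal 𝕜 d hij]
  norm_eq_one_of_ne_zero _ := gramSchmidtNormed_unit_length'
  dense_span := by
    rw [span_gramSchmidtNormed_range, span_gramSchmidt,
      ← Submodule.dense_iff_topologicalClosure_eq_top]
    exact hd.mono Submodule.subset_span

theorem exists_isPaddedHilbertBasis_range [SecondCountableTopology H] {C : Type*}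
    [AddCommGroup C] [Module 𝕜 C] {J₀ : C →ₗ[𝕜] H} (hJ₀ : DenseRange J₀) :
    ∃ c : ℕ → C, IsPaddedHilbertBasis 𝕜 fun l => J₀ (c l) := by
  let d : ℕ → H := Subtype.val ∘ TopologicalSpace.denseSeq (LinearMap.range J₀)
  have hd : DenseRange d := hJ₀.denseRange_val.comp
    (TopologicalSpace.denseRange_denseSeq _) continuous_subtype_val
  have hmem : ∀ l, gramSchmidtNormed 𝕜 d l ∈ LinearMap.range J₀ := fun l =>
    Submodule.smul_mem _ _ <| Submodule.span_le.2 (Set.image_subset_iff.2 fun _ _ => Subtype.prop _)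
      (gramSchmidt_mem_span 𝕜 d le_rfl)
  choose c hc using hmem
  exact ⟨c, by simpa only [hc] using isPaddedHilbertBasis_gramSchmidtNormed hd⟩

variable (𝕜 H) in
theorem exists_isPaddedHilbertBasis [SecondCountableTopology H] :
    ∃ e : ℕ → H, IsPaddedHilbertBasis 𝕜 e :=
  exists_isPaddedHilbertBasis_range (J₀ := LinearMap.id) (denseRange_id (X := H))

namespace IsPaddedHilbertBasis

variable {e : ℕ → H} (he : IsPaddedHilbertBasis 𝕜 e)
include he

theorem norm_le_one (l : ℕ) : ‖e l‖ ≤ 1 := by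
  rcases eq_or_ne (e l) 0 with h | h
  · simp [h]
  · exact (he.norm_eq_one_of_ne_zero l h).le

theorem rankOneSum_apply_of_lt {E : Type*} [NormedAddCommGroup E] [InnerProductSpace 𝕜 E]
    (s : ℕ → E) {l n : ℕ} (hl : l < n) :
    rankOneSum 𝕜 s e n (e l) = inner 𝕜 (e l) (e l) • s l := by
  rw [rankOneSum_apply]
  exact Finset.sum_eq_single_of_mem l (Finset.mem_range.2 hl)
    fun k _ hk => by rw [he.orthogonal hk, zero_smul]

theorem inner_self_eq_one {l : ℕ} (hl : e l ≠ 0) : inner 𝕜 (e l) (e l) = (1 : 𝕜) := by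
  simp [inner_self_eq_norm_sq_to_K, he.norm_eq_one_of_ne_zero l hl]

theorem rankOneSum_apply_self {l n : ℕ} (hl : l < n) : rankOneSum 𝕜 e e n (e l) = e l := by
  rw [he.rankOneSum_apply_of_lt e hl]
  rcases eq_or_ne (e l) 0 with h | h
  · simp [h]
  · rw [he.inner_self_eq_one h, one_smul]

theorem rankOneSum_comp_self (n : ℕ) :
    rankOneSum 𝕜 e e n ∘L rankOneSum 𝕜 e e n = rankOneSum 𝕜 e e n := by
  rw [comp_rankOneSum]
  exact Finset.sum_congr rfl fun l hl =>
    congrArg (rankOne 𝕜 · (e l)) (he.rankOneSum_apply_self (Finset.mem_range.1 hl))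

variable [CompleteSpace H]

theorem norm_rankOneSum_self_le (n : ℕ) : ‖rankOneSum 𝕜 e e n‖ ≤ 1 := by
  have h := norm_adjoint_comp_self (rankOneSum 𝕜 e e n)
  rw [adjoint_rankOneSum, he.rankOneSum_comp_self] at h
  nlinarith [norm_nonneg (rankOneSum 𝕜 e e n)]

theorem tendsto_rankOneSum_apply (z : H) :
    Tendsto (fun n => rankOneSum 𝕜 e e n z) atTop (𝓝 z) := by
  have hequi : Equicontinuous fun n => (rankOneSum 𝕜 e e n : H → H) :=
    (LipschitzWith.uniformEquicontinuous _ 1 fun n =>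
      ContinuousLinearMap.lipschitzWith_of_opNorm_le
        (by simpa using he.norm_rankOneSum_self_le n)).equicontinuous
  suffices h : ∀ x ∈ Submodule.span 𝕜 (Set.range e),
      Tendsto (fun n => rankOneSum 𝕜 e e n x) atTop (𝓝 x) by
    have hz : z ∈ closure (Submodule.span 𝕜 (Set.range e) : Set H) := by
      rw [← Submodule.topologicalClosure_coe, he.dense_span]
      trivial
    exact closure_minimal h (hequi.isClosed_setOfPred_tendsto continuous_id) hz
  intro x hx
  induction hx using Submodule.span_induction with
  | mem x hx =>
    obtain ⟨l, rfl⟩ := hx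
    exact tendsto_const_nhds.congr' <| (eventually_gt_atTop l).mono fun n hn =>
      (he.rankOneSum_apply_self hn).symm
  | zero => simp
  | add x y _ _ hx hy => simpa using hx.add hy
  | smul c x _ hx => simpa using hx.const_smul c

theorem tendsto_rankOneSum_apply_of_tendsto {ι : Type*} {F : Filter ι} {n : ι → ℕ}
    (hn : Tendsto n F atTop) {x : ι → H} {z : H} (hx : Tendsto x F (𝓝 z)) :
    Tendsto (fun α => rankOneSum 𝕜 e e (n α) (x α)) F (𝓝 z) := by
  refine ((he.tendsto_rankOneSum_apply z).comp hn).congr_dist <|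
    squeeze_zero (fun _ => dist_nonneg) (fun α => ?_) (tendsto_iff_norm_sub_tendsto_zero.1 hx)
  rw [dist_comm, dist_eq_norm, Function.comp_apply, ← map_sub]
  simpa using (rankOneSum 𝕜 e e (n α)).le_of_opNorm_le (he.norm_rankOneSum_self_le _) (x α - z)

end IsPaddedHilbertBasis

end PaddedBasis

section AsymptoticIsometry

variable {𝕜 : Type*} [RCLike 𝕜] {ι : Type*} {F : Filter ι}
  {H : Type*} [NormedAddCommGroup H] [InnerProductSpace 𝕜 H]
  {E : ι → Type*} [∀ α, NormedAddCommGroup (E α)] [∀ α, InnerProductSpace 𝕜 (E α)]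

/-- The contractions `T α : H → E α` become isometric in the limit. They serve to transplant
vectors and operators between the limit space `H` and the varying spaces `E α`. -/
structure IsAsymptoticIsometry (F : Filter ι) (T : ∀ α, H →L[𝕜] E α) : Prop where
  norm_le_one : ∀ α, ‖T α‖ ≤ 1
  tendsto_norm : ∀ z, Tendsto (fun α => ‖T α z‖) F (𝓝 ‖z‖)

/-- Strong convergence of `u α ∈ E α` to `w ∈ H` as measured by the transplantation maps `T α`. -/
def StronglyTendsto (F : Filter ι) (T : ∀ α, H →L[𝕜] E α) (u : ∀ α, E α) (w : H) : Prop :=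
  Tendsto (fun α => ‖u α - T α w‖) F (𝓝 0)

theorem StronglyTendsto.add {T : ∀ α, H →L[𝕜] E α} {u v : ∀ α, E α} {w z : H}
    (hu : StronglyTendsto F T u w) (hv : StronglyTendsto F T v z) :
    StronglyTendsto F T (fun α => u α + v α) (w + z) := by
  refine squeeze_zero (fun _ => norm_nonneg _) (fun α => ?_) (by simpa using Tendsto.add hu hv)
  rw [map_add, add_sub_add_comm]
  exact norm_add_le _ _

theorem StronglyTendsto.const_smul {T : ∀ α, H →L[𝕜] E α} {u : ∀ α, E α} {w : H}
    (hu : StronglyTendsto F T u w) (a : 𝕜) :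
    StronglyTendsto F T (fun α => a • u α) (a • w) := by
  simpa [StronglyTendsto, ← smul_sub, norm_smul] using Tendsto.const_mul ‖a‖ hu

theorem norm_adjoint_apply_sub_sq_le {G : Type*} [NormedAddCommGroup G] [InnerProductSpace 𝕜 G]
    [CompleteSpace H] [CompleteSpace G] {T : H →L[𝕜] G} (hT : ‖T‖ ≤ 1) (z : H) :
    ‖adjoint T (T z) - z‖ ^ 2 ≤ ‖z‖ ^ 2 - ‖T z‖ ^ 2 := by
  have hadj : ‖adjoint T (T z)‖ ≤ ‖T z‖ :=
    (adjoint T).le_of_opNorm_le_of_le (by simpa using hT) le_rfl |>.trans_eq (one_mul _)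
  have hinner : RCLike.re (inner 𝕜 (adjoint T (T z)) z) = ‖T z‖ ^ 2 :=
    (apply_norm_sq_eq_inner_adjoint_left T z).symm
  rw [@norm_sub_sq 𝕜, hinner]
  nlinarith [norm_nonneg (adjoint T (T z))]

namespace IsAsymptoticIsometry

variable {T : ∀ α, H →L[𝕜] E α}

theorem norm_apply_le (hT : IsAsymptoticIsometry F T) (α : ι) (z : H) : ‖T α z‖ ≤ ‖z‖ := by
  simpa using (T α).le_of_opNorm_le (hT.norm_le_one α) z

theorem comp_tendsto {κ : Type*} {G : Filter κ} (hT : IsAsymptoticIsometry F T) {h : κ → ι}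
    (hh : Tendsto h G F) : IsAsymptoticIsometry G fun β => T (h β) :=
  ⟨fun β => hT.norm_le_one (h β), fun z => (hT.tendsto_norm z).comp hh⟩

theorem tendsto_norm_of_stronglyTendsto (hT : IsAsymptoticIsometry F T) {u : ∀ α, E α} {w : H}
    (hu : StronglyTendsto F T u w) : Tendsto (fun α => ‖u α‖) F (𝓝 ‖w‖) := by
  refine (hT.tendsto_norm w).congr_dist (squeeze_zero (fun _ => dist_nonneg) (fun α => ?_) hu)
  rw [dist_comm, Real.dist_eq]
  exact abs_norm_sub_norm_le _ _

theorem stronglyTendsto_smul (hT : IsAsymptoticIsometry F T) {c : ι → 𝕜} {c₀ : 𝕜}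
    (hc : Tendsto c F (𝓝 c₀)) {u : ∀ α, E α} {w : H} (hu : StronglyTendsto F T u w) :
    StronglyTendsto F T (fun α => c α • u α) (c₀ • w) := by
  have hdiff : StronglyTendsto F T (fun α => (c α - c₀) • u α) 0 := by
    simpa [StronglyTendsto, norm_smul] using (tendsto_iff_norm_sub_tendsto_zero.1 hc).mul
      (hT.tendsto_norm_of_stronglyTendsto hu)
  simpa [← add_smul] using hdiff.add (hu.const_smul c₀)

theorem stronglyTendsto_of_forall_approx (hT : IsAsymptoticIsometry F T) {u : ∀ α, E α} {w : H}
    (h : ∀ δ > 0, ∃ u' w', StronglyTendsto F T u' w' ∧ ‖w' - w‖ < δ ∧ ∀ᶠ α in F, ‖u α - u' α‖ < δ) :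
    StronglyTendsto F T u w := by
  refine Metric.tendsto_nhds.2 fun δ hδ => ?_
  obtain ⟨u', w', hu', hw', hu⟩ := h (δ / 3) (by positivity)
  filter_upwards [hu, hu'.eventually_lt_const (by positivity : 0 < δ / 3)] with α h₁ h₂
  have hsplit : u α - T α w = (u α - u' α) + (u' α - T α w') + T α (w' - w) := by
    rw [map_sub]
    abel
  rw [dist_zero_right, norm_norm, hsplit]
  linarith [norm_add₃_le (a := u α - u' α) (b := u' α - T α w') (c := T α (w' - w)),
    hT.norm_apply_le α (w' - w)]

variable [CompleteSpace H] [∀ α, CompleteSpace (E α)]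

theorem norm_adjoint_apply_le (hT : IsAsymptoticIsometry F T) (α : ι) (v : E α) :
    ‖adjoint (T α) v‖ ≤ ‖v‖ :=
  (one_mul ‖v‖).le.trans' <|
    (adjoint (T α)).le_of_opNorm_le ((norm_map adjoint (T α)).trans_le (hT.norm_le_one α)) v

theorem tendsto_adjoint_apply (hT : IsAsymptoticIsometry F T) (z : H) :
    Tendsto (fun α => adjoint (T α) (T α z)) F (𝓝 z) := by
  have h : Tendsto (fun α => ‖z‖ ^ 2 - ‖T α z‖ ^ 2) F (𝓝 0) := by
    have h := ((hT.tendsto_norm z).pow 2).const_sub (‖z‖ ^ 2)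
    rwa [sub_self] at h
  have hsq : Tendsto (fun α => ‖adjoint (T α) (T α z) - z‖ ^ 2) F (𝓝 0) :=
    squeeze_zero (fun _ => sq_nonneg _)
      (fun α => norm_adjoint_apply_sub_sq_le (hT.norm_le_one α) z) h
  exact tendsto_iff_norm_sub_tendsto_zero.2 (by simpa using hsq.sqrt)

theorem tendsto_adjoint_of_stronglyTendsto (hT : IsAsymptoticIsometry F T) {u : ∀ α, E α} {w : H}
    (hu : StronglyTendsto F T u w) : Tendsto (fun α => adjoint (T α) (u α)) F (𝓝 w) := by
  refine (hT.tendsto_adjoint_apply w).congr_dist (squeeze_zero (fun _ => dist_nonneg)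
    (fun α => ?_) hu)
  rw [dist_comm, dist_eq_norm, ← map_sub]
  exact hT.norm_adjoint_apply_le α _

theorem tendsto_inner (hT : IsAsymptoticIsometry F T) {u v : ∀ α, E α} {w z : H}
    (hu : StronglyTendsto F T u w) (hv : StronglyTendsto F T v z) :
    Tendsto (fun α => inner 𝕜 (u α) (v α)) F (𝓝 (inner 𝕜 w z)) := by
  have hsub : Tendsto (fun α => inner 𝕜 (u α) (v α - T α z)) F (𝓝 0) := by
    have h := (hT.tendsto_norm_of_stronglyTendsto hu).mul hv
    rw [mul_zero] at h
    exact squeeze_zero_norm (fun α => norm_inner_le_norm _ _) h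
  have hadd := hsub.add ((hT.tendsto_adjoint_of_stronglyTendsto hu).inner
    (tendsto_const_nhds (x := z)))
  simp only [zero_add] at hadd
  refine hadd.congr fun α => ?_
  rw [adjoint_inner_left, ← inner_add_right, sub_add_cancel]

end IsAsymptoticIsometry

end AsymptoticIsometry

section Construction

variable {𝕜 : Type*} [RCLike 𝕜] {ι : Type*} {F : Filter ι}
  {H : Type*} [NormedAddCommGroup H] [InnerProductSpace 𝕜 H]
  {E : ι → Type*} [∀ α, NormedAddCommGroup (E α)] [∀ α, InnerProductSpace 𝕜 (E α)]
  {C : Type*} [AddCommGroup C] [Module 𝕜 C] {J : ∀ α, C →ₗ[𝕜] E α} {J₀ : C →ₗ[𝕜] H}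

theorem tendsto_inner_of_tendsto_norm
    (hJ : ∀ v, Tendsto (fun α => ‖J α v‖) F (𝓝 ‖J₀ v‖)) (v w : C) :
    Tendsto (fun α => inner 𝕜 (J α v) (J α w)) F (𝓝 (inner 𝕜 (J₀ v) (J₀ w))) := by
  have hcoe : ∀ v, Tendsto (fun α => (‖J α v‖ : 𝕜)) F (𝓝 (‖J₀ v‖ : 𝕜)) := fun v =>
    (RCLike.continuous_ofReal.tendsto _).comp (hJ v)
  simp only [inner_eq_sum_norm_sq_div_four, ← map_smul, ← map_add, ← map_sub]
  exact (((((hcoe _).pow 2).sub ((hcoe _).pow 2))).add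
    ((((hcoe _).pow 2).sub ((hcoe _).pow 2)).mul_const _)).div_const _

theorem exists_isAsymptoticIsometry_of_norm_le {S : ∀ α, H →L[𝕜] E α} {b : ι → ℝ}
    (hb : Tendsto b F (𝓝 1)) (hSb : ∀ α, ‖S α‖ ≤ b α)
    (hS : ∀ z, Tendsto (fun α => ‖S α z‖) F (𝓝 ‖z‖)) :
    ∃ T : ∀ α, H →L[𝕜] E α, IsAsymptoticIsometry F T ∧
      ∀ z, StronglyTendsto F T (fun α => S α z) z := by
  let r : ι → ℝ := fun α => (max 1 (b α))⁻¹
  have hr_pos : ∀ α, 0 < r α := fun α => inv_pos.2 (lt_max_of_lt_left one_pos)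
  have hr : Tendsto r F (𝓝 1) := by
    simpa using (tendsto_const_nhds.max hb).inv₀ (by simp : max (1 : ℝ) 1 ≠ 0)
  have hnorm_coe : ∀ α, ‖(r α : 𝕜)‖ = r α := fun α => by
    rw [RCLike.norm_ofReal, abs_of_pos (hr_pos α)]
  refine ⟨fun α => (r α : 𝕜) • S α, ⟨fun α => ?_, fun z => ?_⟩, fun z => ?_⟩
  · rw [norm_smul, hnorm_coe]
    exact inv_mul_le_one_of_le₀ ((hSb α).trans (le_max_right _ _)) (by positivity)
  · simpa [norm_smul, hnorm_coe] using hr.mul (hS z)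
  · have h := ((hr.const_sub 1).abs.mul (hS z))
    rw [sub_self, abs_zero, zero_mul] at h
    refine h.congr fun α => ?_
    rw [smul_apply, ← RCLike.norm_ofReal (K := 𝕜), ← norm_smul]
    simp [sub_smul]

theorem stronglyTendsto_of_mem_span {T : ∀ α, H →L[𝕜] E α} {c : ℕ → C}
    (hTc : ∀ l, StronglyTendsto F T (fun α => J α (c l)) (J₀ (c l))) {v : C}
    (hv : v ∈ Submodule.span 𝕜 (Set.range c)) :
    StronglyTendsto F T (fun α => J α v) (J₀ v) := by
  induction hv using Submodule.span_induction with
  | mem v hv =>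
    obtain ⟨l, rfl⟩ := hv
    exact hTc l
  | zero => simpa [StronglyTendsto] using tendsto_const_nhds
  | add v w _ _ hv hw => simpa only [map_add] using hv.add hw
  | smul a v _ hv => simpa only [map_smul] using hv.const_smul a

theorem IsAsymptoticIsometry.stronglyTendsto_of_padded {T : ∀ α, H →L[𝕜] E α}
    (hT : IsAsymptoticIsometry F T)
    (hJ : ∀ v, Tendsto (fun α => ‖J α v‖) F (𝓝 ‖J₀ v‖)) {c : ℕ → C}
    (hc : IsPaddedHilbertBasis 𝕜 fun l => J₀ (c l))
    (hTc : ∀ l, StronglyTendsto F T (fun α => J α (c l)) (J₀ (c l))) (v : C) :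
    StronglyTendsto F T (fun α => J α v) (J₀ v) := by
  refine hT.stronglyTendsto_of_forall_approx fun δ hδ => ?_
  obtain ⟨x, hx, hxδ⟩ := Metric.dense_iff.1
    (Submodule.dense_iff_topologicalClosure_eq_top.2 hc.dense_span) (J₀ v) δ hδ
  rw [SetLike.mem_coe, Set.range_comp' J₀ c, Submodule.span_image] at hxδ
  obtain ⟨v', hv', rfl⟩ := hxδ
  rw [Metric.mem_ball, dist_eq_norm] at hx
  refine ⟨fun α => J α v', J₀ v', stronglyTendsto_of_mem_span hTc hv', hx, ?_⟩
  simp only [← map_sub]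
  refine (hJ (v - v')).eventually_lt_const ?_
  rwa [map_sub, norm_sub_rev]

theorem norm_adjoint_comp_sub_le {G : Type*} [NormedAddCommGroup G] [InnerProductSpace 𝕜 G]
    [CompleteSpace H] [CompleteSpace G] (s : ℕ → G) {e : ℕ → H} (he : IsPaddedHilbertBasis 𝕜 e)
    (n : ℕ) :
    ‖adjoint (rankOneSum 𝕜 s e n) ∘L rankOneSum 𝕜 s e n - rankOneSum 𝕜 e e n‖ ≤
      ∑ l ∈ Finset.range n, ‖rankOneSum 𝕜 e s n (s l) - e l‖ := by
  rw [adjoint_rankOneSum, comp_rankOneSum, rankOneSum_sub]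
  exact norm_rankOneSum_le _ he.norm_le_one n

variable [CompleteSpace H] [∀ α, CompleteSpace (E α)]

theorem tendsto_norm_adjoint_comp_sub (hJ : ∀ v, Tendsto (fun α => ‖J α v‖) F (𝓝 ‖J₀ v‖))
    {c : ℕ → C} (hc : IsPaddedHilbertBasis 𝕜 fun l => J₀ (c l)) (n : ℕ) :
    Tendsto (fun α => ‖adjoint (rankOneSum 𝕜 (fun l => J α (c l)) (fun l => J₀ (c l)) n) ∘L
        rankOneSum 𝕜 (fun l => J α (c l)) (fun l => J₀ (c l)) n -
        rankOneSum 𝕜 (fun l => J₀ (c l)) (fun l => J₀ (c l)) n‖) F (𝓝 0) := by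
  refine squeeze_zero (fun _ => norm_nonneg _)
    (fun α => norm_adjoint_comp_sub_le (fun l => J α (c l)) hc n) ?_
  rw [← Finset.sum_const_zero (s := Finset.range n)]
  refine tendsto_finsetSum _ fun l hl => tendsto_iff_norm_sub_tendsto_zero.1 ?_
  rw [← hc.rankOneSum_apply_self (Finset.mem_range.1 hl)]
  simp only [rankOneSum_apply]
  exact tendsto_finsetSum _ fun k _ => (tendsto_inner_of_tendsto_norm hJ _ _).smul_const _

theorem norm_le_one_add_norm_adjoint_comp_sub {G : Type*} [NormedAddCommGroup G]
    [InnerProductSpace 𝕜 G] [CompleteSpace G] (S : H →L[𝕜] G) {P : H →L[𝕜] H} (hP : ‖P‖ ≤ 1) :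
    ‖S‖ ≤ 1 + ‖adjoint S ∘L S - P‖ := by
  have h : ‖S‖ * ‖S‖ ≤ 1 + ‖adjoint S ∘L S - P‖ := by
    rw [← norm_adjoint_comp_self]
    linarith [norm_le_insert P (adjoint S ∘L S), norm_sub_rev P (adjoint S ∘L S)]
  nlinarith [norm_nonneg (adjoint S ∘L S - P)]

theorem tendsto_norm_of_adjoint_comp_sub {S : ∀ α, H →L[𝕜] E α} {P : ι → H →L[𝕜] H} {z : H}
    (hP : Tendsto (fun α => P α z) F (𝓝 z))
    (hS : Tendsto (fun α => ‖adjoint (S α) ∘L S α - P α‖) F (𝓝 0)) :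
    Tendsto (fun α => ‖S α z‖) F (𝓝 ‖z‖) := by
  have hgram : Tendsto (fun α => adjoint (S α) (S α z)) F (𝓝 z) := by
    refine hP.congr_dist (squeeze_zero (fun _ => dist_nonneg) (fun α => ?_)
      (by simpa using hS.mul_const ‖z‖))
    rw [dist_comm, dist_eq_norm]
    exact (adjoint (S α) ∘L S α - P α).le_opNorm z
  have hsq : Tendsto (fun α => ‖S α z‖ ^ 2) F (𝓝 (‖z‖ ^ 2)) := by
    rw [@norm_sq_eq_re_inner 𝕜 _ _ _ _ z]
    refine ((RCLike.continuous_re.tendsto _).comp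
      (hgram.inner (tendsto_const_nhds (x := z)))).congr fun α => ?_
    exact (apply_norm_sq_eq_inner_adjoint_left (S α) z).symm
  simpa using hsq.sqrt

theorem exists_isAsymptoticIsometry [SecondCountableTopology H] {M : ι → ℕ}
    (hM : Tendsto M F atTop) (hJ₀ : DenseRange J₀)
    (hJ : ∀ v, Tendsto (fun α => ‖J α v‖) F (𝓝 ‖J₀ v‖)) :
    ∃ T : ∀ α, H →L[𝕜] E α, IsAsymptoticIsometry F T ∧
      ∀ v, StronglyTendsto F T (fun α => J α v) (J₀ v) := by
  obtain ⟨c, hc⟩ := exists_isPaddedHilbertBasis_range hJ₀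
  obtain ⟨n, hn, hgram⟩ :=
    exists_tendsto_atTop_diagonal hM fun n => tendsto_norm_adjoint_comp_sub hJ hc n
  obtain ⟨T, hT, hST⟩ := exists_isAsymptoticIsometry_of_norm_le
    (by simpa using hgram.const_add 1)
    (fun α => norm_le_one_add_norm_adjoint_comp_sub _ (hc.norm_rankOneSum_self_le (n α)))
    fun z => tendsto_norm_of_adjoint_comp_sub ((hc.tendsto_rankOneSum_apply z).comp hn) hgram
  refine ⟨T, hT, hT.stronglyTendsto_of_padded hJ hc fun l => ?_⟩
  rcases eq_or_ne (J₀ (c l)) 0 with hl | hl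
  · simpa [StronglyTendsto, hl] using hJ (c l)
  · refine (hST (J₀ (c l))).congr' ?_
    filter_upwards [hn.eventually_gt_atTop l] with α hα
    rw [hc.rankOneSum_apply_of_lt _ hα, hc.inner_self_eq_one hl, one_smul]

end Construction

section CompactOperators

variable {𝕜 : Type*} [RCLike 𝕜] {ι : Type*} {F : Filter ι}

theorem tendsto_norm_zero_of_isCompactOperator {H G : Type*} [NormedAddCommGroup H]
    [InnerProductSpace 𝕜 H] [CompleteSpace H] [NormedAddCommGroup G] [InnerProductSpace 𝕜 G]
    [CompleteSpace G] {K : H →L[𝕜] G} (hK : IsCompactOperator K) {x : ι → H} {B : ℝ}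
    (hB : ∀ α, ‖x α‖ ≤ B) (hx : ∀ z, Tendsto (fun α => inner 𝕜 (x α) z) F (𝓝 0)) :
    Tendsto (fun α => ‖K (x α)‖) F (𝓝 0) := by
  refine tendsto_zero_iff_norm_tendsto_zero.1 ((tendsto_iff_ultrafilter _ _ _).2 fun U hU => ?_)
  obtain ⟨C, hC, hKC⟩ := hK.image_closedBall_subset_compact (f := (K : H →ₗ[𝕜] G)) B
  have hmem : ∀ᶠ α in U, K (x α) ∈ C :=
    Eventually.of_forall fun α => hKC ⟨x α, by simpa using hB α, rfl⟩
  obtain ⟨y, -, hy⟩ := hC.ultrafilter_le_nhds' (U.map fun α => K (x α)) hmem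
  have hweak : Tendsto (fun α => inner 𝕜 (K (x α)) y) U (𝓝 0) := by
    simpa only [adjoint_inner_right] using (hx (adjoint K y)).mono_left hU
  have hself : Tendsto (fun α => inner 𝕜 (K (x α)) y) U (𝓝 (inner 𝕜 y y)) :=
    Tendsto.inner hy tendsto_const_nhds
  rwa [inner_self_eq_zero.1 (tendsto_nhds_unique hself hweak)] at hy

theorem exists_opNorm_le_two_mul {E G : Type*} [NormedAddCommGroup E] [NormedSpace 𝕜 E]
    [NormedAddCommGroup G] [NormedSpace 𝕜 G] (D : E →L[𝕜] G) :
    ∃ x, ‖x‖ ≤ 1 ∧ ‖D‖ ≤ 2 * ‖D x‖ := by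
  rcases (norm_nonneg D).eq_or_lt with h | h
  · exact ⟨0, by simp, by simp [← h]⟩
  · obtain ⟨x, hx, hDx⟩ := D.exists_lt_apply_of_lt_opNorm (half_lt_self h)
    exact ⟨x, hx.le, by linarith⟩

theorem tendsto_opNorm_zero {E G : ι → Type*} [∀ α, NormedAddCommGroup (E α)]
    [∀ α, NormedSpace 𝕜 (E α)] [∀ α, NormedAddCommGroup (G α)] [∀ α, NormedSpace 𝕜 (G α)]
    {D : ∀ α, E α →L[𝕜] G α}
    (hD : ∀ u : ∀ α, E α, (∀ α, ‖u α‖ ≤ 1) → Tendsto (fun α => ‖D α (u α)‖) F (𝓝 0)) :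
    Tendsto (fun α => ‖D α‖) F (𝓝 0) := by
  choose u hu hDu using fun α => exists_opNorm_le_two_mul (D α)
  exact squeeze_zero (fun _ => norm_nonneg _) hDu (by simpa using (hD u hu).const_mul 2)

theorem tendsto_inner_sub_apply_zero {E : ι → Type*} [∀ α, NormedAddCommGroup (E α)]
    [∀ α, InnerProductSpace 𝕜 (E α)] [∀ α, CompleteSpace (E α)] {Q : ∀ α, E α →L[𝕜] E α}
    (hQ : ∀ α, IsSelfAdjoint (Q α)) {x v : ∀ α, E α} (hx : ∀ α, ‖x α‖ ≤ 1)
    (hv : Tendsto (fun α => ‖v α - Q α (v α)‖) F (𝓝 0)) :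
    Tendsto (fun α => inner 𝕜 (x α - Q α (x α)) (v α)) F (𝓝 0) := by
  refine squeeze_zero_norm (fun α => ?_) hv
  have hmove : inner 𝕜 (x α - Q α (x α)) (v α) = inner 𝕜 (x α) (v α - Q α (v α)) := by
    rw [inner_sub_left, inner_sub_right, (hQ α).isSymmetric.apply_clm]
  rw [hmove]
  exact (norm_inner_le_norm _ _).trans (mul_le_of_le_one_left (norm_nonneg _) (hx α))

theorem norm_sub_apply_le_two {E : Type*} [NormedAddCommGroup E] [NormedSpace 𝕜 E]
    {Q : E →L[𝕜] E} (hQ : ‖Q‖ ≤ 1) {x : E} (hx : ‖x‖ ≤ 1) : ‖x - Q x‖ ≤ 2 := by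
  linarith [norm_sub_le x (Q x), Q.le_of_opNorm_le_of_le hQ hx]

end CompactOperators

section CompactConvergence

variable {𝕜 : Type*} [RCLike 𝕜] {ι : Type*} {F : Filter ι}
  {H : Type*} [NormedAddCommGroup H] [InnerProductSpace 𝕜 H]
  {E : ι → Type*} [∀ α, NormedAddCommGroup (E α)] [∀ α, InnerProductSpace 𝕜 (E α)]
  {T : ∀ α, H →L[𝕜] E α} {R : ∀ α, E α →L[𝕜] E α} {R₀ : H →L[𝕜] H}

/-- Weak convergence of `u α ∈ E α` to `w ∈ H` as measured by the transplantation maps `T α`. -/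
def WeaklyTendsto (F : Filter ι) (T : ∀ α, H →L[𝕜] E α) (u : ∀ α, E α) (w : H) : Prop :=
  ∀ z, Tendsto (fun α => inner 𝕜 (u α) (T α z)) F (𝓝 (inner 𝕜 w z))

/-- Compact convergence of operators as measured by the transplantation maps `T α`, tested on
bounded families only. -/
def CompactlyTendsto (F : Filter ι) (T : ∀ α, H →L[𝕜] E α) (R : ∀ α, E α →L[𝕜] E α)
    (R₀ : H →L[𝕜] H) : Prop :=
  ∀ (u : ∀ α, E α) (w : H) (B : ℝ), (∀ α, ‖u α‖ ≤ B) → WeaklyTendsto F T u w →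
    StronglyTendsto F T (fun α => R α (u α)) (R₀ w)

theorem CompactlyTendsto.tendsto_norm_zero (hR : CompactlyTendsto F T R R₀) {u : ∀ α, E α} {B : ℝ}
    (hB : ∀ α, ‖u α‖ ≤ B) (hu : WeaklyTendsto F T u 0) :
    Tendsto (fun α => ‖R α (u α)‖) F (𝓝 0) := by
  simpa [StronglyTendsto] using hR u 0 B hB hu

variable [CompleteSpace H] [∀ α, CompleteSpace (E α)]

theorem WeaklyTendsto.tendsto_inner_adjoint {u : ∀ α, E α} (hu : WeaklyTendsto F T u 0) (z : H) :
    Tendsto (fun α => inner 𝕜 (adjoint (T α) (u α)) z) F (𝓝 0) := by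
  simpa only [adjoint_inner_left, inner_zero_left] using hu z

namespace IsAsymptoticIsometry

variable (hT : IsAsymptoticIsometry F T)
include hT

theorem weaklyTendsto_apply {x : ι → H} {w : H} {B : ℝ} (hB : ∀ α, ‖x α‖ ≤ B)
    (hx : ∀ z, Tendsto (fun α => inner 𝕜 (x α) z) F (𝓝 (inner 𝕜 w z))) :
    WeaklyTendsto F T (fun α => T α (x α)) w := by
  intro z
  have herr : Tendsto (fun α => inner 𝕜 (x α) (adjoint (T α) (T α z) - z)) F (𝓝 0) := by
    refine squeeze_zero_norm (fun α => (norm_inner_le_norm _ _).trans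
      (mul_le_mul_of_nonneg_right (hB α) (norm_nonneg _))) ?_
    simpa using (tendsto_iff_norm_sub_tendsto_zero.1 (hT.tendsto_adjoint_apply z)).const_mul B
  have hsum := (hx z).add herr
  simp only [← inner_add_right, add_sub_cancel, add_zero, adjoint_inner_right] at hsum
  exact hsum

theorem norm_comp_adjoint_le {α : ι} {P : H →L[𝕜] H} (hP : ‖P‖ ≤ 1) :
    ‖T α ∘L P ∘L adjoint (T α)‖ ≤ 1 := by
  have hadj : ‖adjoint (T α)‖ ≤ 1 := (norm_map adjoint (T α)).trans_le (hT.norm_le_one α)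
  exact (opNorm_comp_le _ _).trans <| mul_le_one₀ (hT.norm_le_one α) (norm_nonneg _) <|
    (opNorm_comp_le _ _).trans <| mul_le_one₀ hP (norm_nonneg _) hadj

theorem norm_adjoint_comp_self_le (α : ι) : ‖adjoint (T α) ∘L T α‖ ≤ 1 := by
  rw [norm_adjoint_comp_self]
  exact mul_le_one₀ (hT.norm_le_one α) (norm_nonneg _) (hT.norm_le_one α)

theorem tendsto_norm_comp_one_sub {K : H →L[𝕜] H} (hK : IsCompactOperator K) :
    Tendsto (fun α => ‖K ∘L (1 - adjoint (T α) ∘L T α)‖) F (𝓝 0) :=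
  tendsto_opNorm_zero fun _ hx => tendsto_norm_zero_of_isCompactOperator hK
    (fun α => norm_sub_apply_le_two (hT.norm_adjoint_comp_self_le α) (hx α)) fun z =>
    tendsto_inner_sub_apply_zero (fun α => isSelfAdjoint_iff'.2 <| by simp [adjoint_comp]) hx <| by
      simpa only [norm_sub_rev z, comp_apply] using
        tendsto_iff_norm_sub_tendsto_zero.1 (hT.tendsto_adjoint_apply z)

end IsAsymptoticIsometry

theorem isSelfAdjoint_rankOneSum (e : ℕ → H) (n : ℕ) :
    IsSelfAdjoint (rankOneSum 𝕜 e e n) :=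
  isSelfAdjoint_iff'.2 (adjoint_rankOneSum e e n)

namespace CompactlyTendsto

variable (hR : CompactlyTendsto F T R R₀) (hT : IsAsymptoticIsometry F T)
include hR hT

theorem stronglyTendsto_apply (z : H) : StronglyTendsto F T (fun α => R α (T α z)) (R₀ z) :=
  hR _ z ‖z‖ (fun α => hT.norm_apply_le α z) (hT.weaklyTendsto_apply (fun _ => le_rfl)
    fun _ => tendsto_const_nhds)

theorem isCompactOperator [SecondCountableTopology H] [F.NeBot] {M : ι → ℕ}
    (hM : Tendsto M F atTop) : IsCompactOperator R₀ := by
  obtain ⟨e, he⟩ := exists_isPaddedHilbertBasis 𝕜 H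
  let P : ℕ → H →L[𝕜] H := rankOneSum 𝕜 e e
  choose x hx hRx using fun n => exists_opNorm_le_two_mul (R₀ - R₀ ∘L P n)
  let y : ℕ → H := fun n => x n - P n (x n)
  obtain ⟨n, hn, hdiag⟩ := exists_tendsto_atTop_diagonal hM fun n => by
    have h := (hT.tendsto_norm_of_stronglyTendsto (hR.stronglyTendsto_apply hT (y n))).const_sub
      ‖R₀ (y n)‖
    rwa [sub_self] at h
  have hy : ∀ z, Tendsto (fun α => inner 𝕜 (y (n α)) z) F (𝓝 0) := fun z =>
    tendsto_inner_sub_apply_zero (Q := fun α => P (n α)) (fun α => isSelfAdjoint_rankOneSum e (n α))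
      (fun α => hx (n α)) <| by
      simpa only [norm_sub_rev z, Function.comp_apply] using
        tendsto_iff_norm_sub_tendsto_zero.1 ((he.tendsto_rankOneSum_apply z).comp hn)
  have hnorm : ∀ α, ‖y (n α)‖ ≤ 2 := fun α =>
    norm_sub_apply_le_two (he.norm_rankOneSum_self_le _) (hx _)
  have hRTy : Tendsto (fun α => ‖R α (T α (y (n α)))‖) F (𝓝 0) :=
    hR.tendsto_norm_zero (fun α => (hT.norm_apply_le α _).trans (hnorm α)) <|
      hT.weaklyTendsto_apply hnorm fun z => by simpa only [inner_zero_left] using hy z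
  have hRy : Tendsto (fun α => 2 * ‖R₀ (y (n α))‖) F (𝓝 0) := by
    simpa using (hdiag.add hRTy).const_mul 2
  have hRP : Tendsto (fun α => R₀ ∘L P (n α)) F (𝓝 R₀) := by
    refine tendsto_iff_norm_sub_tendsto_zero.2 <|
      squeeze_zero (fun _ => norm_nonneg _) (fun α => ?_) hRy
    simpa [norm_sub_rev _ R₀, y] using hRx (n α)
  exact isCompactOperator_of_tendsto hRP <| Eventually.of_forall fun α =>
    (isCompactOperator_rankOneSum e e (n α)).clm_comp R₀

theorem tendsto_norm_sub_apply_apply (z : H) :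
    Tendsto (fun α => ‖(R α - T α ∘L R₀ ∘L adjoint (T α)) (T α z)‖) F (𝓝 0) := by
  have herr : Tendsto (fun α => ‖R₀ (z - adjoint (T α) (T α z))‖) F (𝓝 0) := by
    simpa using ((R₀.continuous.tendsto _).comp ((hT.tendsto_adjoint_apply z).const_sub z)).norm
  have hsum := Tendsto.add (hR.stronglyTendsto_apply hT z) herr
  rw [add_zero] at hsum
  refine squeeze_zero (fun _ => norm_nonneg _) (fun α => ?_) hsum
  have hsplit : (R α - T α ∘L R₀ ∘L adjoint (T α)) (T α z) =
      (R α (T α z) - T α (R₀ z)) + T α (R₀ (z - adjoint (T α) (T α z))) := by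
    simp
  rw [hsplit]
  exact (norm_add_le _ _).trans (add_le_add_right (hT.norm_apply_le α _) _)

theorem tendsto_norm_sub_comp_rankOneSum {e : ℕ → H} (he : ∀ l, ‖e l‖ ≤ 1) (n : ℕ) :
    Tendsto (fun α => ‖((R α - T α ∘L R₀ ∘L adjoint (T α)) ∘L T α) ∘L rankOneSum 𝕜 e e n‖) F
      (𝓝 0) := by
  simp only [comp_rankOneSum]
  refine squeeze_zero (fun _ => norm_nonneg _) (fun α => norm_rankOneSum_le _ he n) ?_
  rw [← Finset.sum_const_zero (s := Finset.range n)]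
  exact tendsto_finsetSum _ fun l _ => hR.tendsto_norm_sub_apply_apply hT (e l)

theorem tendsto_norm_sub_apply_of_weaklyTendsto_zero (hR₀ : IsCompactOperator R₀) {u : ∀ α, E α}
    {B : ℝ} (hB : ∀ α, ‖u α‖ ≤ B) (hu : WeaklyTendsto F T u 0) :
    Tendsto (fun α => ‖(R α - T α ∘L R₀ ∘L adjoint (T α)) (u α)‖) F (𝓝 0) := by
  have hcompact := tendsto_norm_zero_of_isCompactOperator hR₀
    (fun α => (hT.norm_adjoint_apply_le α (u α)).trans (hB α)) hu.tendsto_inner_adjoint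
  have hsum := (hR.tendsto_norm_zero hB hu).add hcompact
  rw [add_zero] at hsum
  refine squeeze_zero (fun _ => norm_nonneg _) (fun α => ?_) hsum
  exact (norm_sub_le _ _).trans (add_le_add_right (hT.norm_apply_le α _) _)

theorem tendsto_norm_sub (hR₀ : IsCompactOperator R₀) [SecondCountableTopology H] {M : ι → ℕ}
    (hM : Tendsto M F atTop) :
    Tendsto (fun α => ‖R α - T α ∘L R₀ ∘L adjoint (T α)‖) F (𝓝 0) := by
  obtain ⟨e, he⟩ := exists_isPaddedHilbertBasis 𝕜 H
  let P : ℕ → H →L[𝕜] H := rankOneSum 𝕜 e e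
  obtain ⟨n, hn, hdiag⟩ := exists_tendsto_atTop_diagonal hM
    (hR.tendsto_norm_sub_comp_rankOneSum hT he.norm_le_one)
  let Q : ∀ α, E α →L[𝕜] E α := fun α => T α ∘L P (n α) ∘L adjoint (T α)
  have hQ : ∀ α, ‖Q α‖ ≤ 1 := fun α => hT.norm_comp_adjoint_le (he.norm_rankOneSum_self_le _)
  refine tendsto_opNorm_zero fun u hu => ?_
  have hweak : WeaklyTendsto F T (fun α => u α - Q α (u α)) 0 := fun z => by
    rw [inner_zero_left]
    refine tendsto_inner_sub_apply_zero
      (fun α => (isSelfAdjoint_rankOneSum e (n α)).conj_adjoint (T α)) hu ?_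
    have hPz := he.tendsto_rankOneSum_apply_of_tendsto hn (hT.tendsto_adjoint_apply z)
    refine squeeze_zero (fun _ => norm_nonneg _) (fun α => ?_)
      (tendsto_iff_norm_sub_tendsto_zero.1 hPz)
    rw [norm_sub_rev, comp_apply, ← map_sub]
    exact hT.norm_apply_le α _
  have htail := hR.tendsto_norm_sub_apply_of_weaklyTendsto_zero hT hR₀
    (fun α => norm_sub_apply_le_two (hQ α) (hu α)) hweak
  have hsum := htail.add hdiag
  rw [add_zero] at hsum
  refine squeeze_zero (fun _ => norm_nonneg _) (fun α => ?_) hsum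
  set D := R α - T α ∘L R₀ ∘L adjoint (T α)
  have hsplit : D (u α) = D (u α - Q α (u α)) + (D ∘L T α ∘L P (n α)) (adjoint (T α) (u α)) := by
    simp [Q]
  rw [hsplit]
  exact (norm_add_le _ _).trans <| add_le_add_right ((le_opNorm _ _).trans <|
    mul_le_of_le_one_right (norm_nonneg _) ((hT.norm_adjoint_apply_le α _).trans (hu α))) _

theorem tendsto_norm_sub_adjoint (hR₀ : IsCompactOperator R₀) (hsymm : IsSelfAdjoint R₀)
    [SecondCountableTopology H] {M : ι → ℕ} (hM : Tendsto M F atTop) :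
    Tendsto (fun α => ‖R₀ - adjoint (T α) ∘L R α ∘L T α‖) F (𝓝 0) := by
  have hright := hT.tendsto_norm_comp_one_sub hR₀
  have hsum := (hright.const_mul 2).add (hR.tendsto_norm_sub hT hR₀ hM)
  rw [mul_zero, add_zero] at hsum
  refine squeeze_zero (fun _ => norm_nonneg _) (fun α => ?_) hsum
  set K := adjoint (T α) ∘L T α
  set D := R α - T α ∘L R₀ ∘L adjoint (T α)
  have hK : ‖K‖ ≤ 1 := hT.norm_adjoint_comp_self_le α
  have hleft : ‖(1 - K) ∘L R₀‖ = ‖R₀ ∘L (1 - K)‖ := by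
    rw [← norm_map adjoint, adjoint_comp, hsymm.adjoint_eq, map_sub, isSelfAdjoint_iff'.1 (.one _),
      adjoint_comp, adjoint_adjoint]
  have hmid : ‖adjoint (T α) ∘L D ∘L T α‖ ≤ ‖D‖ :=
    (opNorm_comp_le _ _).trans <| (mul_le_of_le_one_left (norm_nonneg _)
      ((norm_map adjoint (T α)).trans_le (hT.norm_le_one α))).trans <|
      (opNorm_comp_le _ _).trans <| mul_le_of_le_one_right (norm_nonneg _) (hT.norm_le_one α)
  have hKR : ‖K ∘L R₀ ∘L (1 - K)‖ ≤ ‖R₀ ∘L (1 - K)‖ :=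
    (opNorm_comp_le _ _).trans (mul_le_of_le_one_left (norm_nonneg _) hK)
  have hsplit : R₀ - adjoint (T α) ∘L R α ∘L T α =
      (1 - K) ∘L R₀ + K ∘L R₀ ∘L (1 - K) - adjoint (T α) ∘L D ∘L T α := by
    ext z
    simp [K, D]
  rw [hsplit]
  linarith [norm_sub_le ((1 - K) ∘L R₀ + K ∘L R₀ ∘L (1 - K)) (adjoint (T α) ∘L D ∘L T α),
    norm_add_le ((1 - K) ∘L R₀) (K ∘L R₀ ∘L (1 - K))]

end CompactlyTendsto

end CompactConvergence

section Resolvent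

variable {𝕜 : Type*} [RCLike 𝕜] {H : Type*} [NormedAddCommGroup H] [InnerProductSpace 𝕜 H]

theorem isResolventAt_neg_one_iff {A : H →ₗ.[𝕜] H} {R : H →L[𝕜] H} :
    IsResolventAt A (-1) (-R) ↔ ∀ x y, (x, y) ∈ A.graph ↔ R (x + y) = x := by
  constructor
  · rintro ⟨hright, hleft⟩ x y
    constructor
    · rintro hxy
      obtain ⟨x, rfl, rfl⟩ := (LinearPMap.mem_graph_iff _).1 hxy
      have h := hleft x
      rwa [neg_smul, one_smul, ← neg_add', neg_apply, map_neg, neg_neg] at h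
    · intro hR
      have hx := hright (x + y)
      rw [neg_apply, hR] at hx
      obtain ⟨hdom, h⟩ := hx
      rw [neg_smul, one_smul, neg_neg, sub_eq_add_neg, add_right_inj] at h
      have hgraph := A.graph.neg_mem (A.mem_graph ⟨_, hdom⟩)
      rwa [Prod.neg_mk, neg_neg, h] at hgraph
  · intro h
    have hgraph : ∀ u, (-R u, R u - u) ∈ A.graph := fun u => by
      simpa using A.graph.neg_mem ((h (R u) (u - R u)).2 (by rw [add_sub_cancel]))
    refine ⟨fun u => ?_, fun x => ?_⟩
    · obtain ⟨⟨x, hx⟩, rfl, hAx⟩ := (LinearPMap.mem_graph_iff _).1 (hgraph u)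
      exact ⟨hx, by simp [hAx]⟩
    · rw [neg_smul, one_smul, ← neg_add', neg_apply, map_neg, neg_neg]
      exact (h x (A x)).1 (A.mem_graph x)

variable [CompleteSpace H]

namespace SpectralStructure

variable (S : SpectralStructure 𝕜 H)

theorem inner_nonneg_of_mem_graph {x y : H} (hxy : (x, y) ∈ S.A.graph) :
    0 ≤ RCLike.re (inner 𝕜 y x) := by
  obtain ⟨x, rfl, rfl⟩ := (LinearPMap.mem_graph_iff _).1 hxy
  exact S.nonneg x

theorem inner_eq_of_mem_graph {x y x' y' : H} (hxy : (x, y) ∈ S.A.graph)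
    (hxy' : (x', y') ∈ S.A.graph) : inner 𝕜 y x' = inner 𝕜 x y' := by
  obtain ⟨x, rfl, rfl⟩ := (LinearPMap.mem_graph_iff _).1 hxy
  obtain ⟨x', rfl, rfl⟩ := (LinearPMap.mem_graph_iff _).1 hxy'
  have h := LinearPMap.adjoint_isFormalAdjoint S.selfAdjoint.dense_domain
  rw [LinearPMap.isSelfAdjoint_def.1 S.selfAdjoint] at h
  exact h x x'

theorem sq_norm_le_re_inner_add {x y : H} (hxy : (x, y) ∈ S.A.graph) :
    ‖x‖ ^ 2 ≤ RCLike.re (inner 𝕜 (x + y) x) := by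
  rw [inner_add_left, map_add, ← norm_sq_eq_re_inner]
  exact le_add_of_nonneg_right (S.inner_nonneg_of_mem_graph hxy)

theorem norm_le_norm_add {x y : H} (hxy : (x, y) ∈ S.A.graph) : ‖x‖ ≤ ‖x + y‖ := by
  have h := (S.sq_norm_le_re_inner_add hxy).trans (re_inner_le_norm _ _)
  by_contra! hlt
  nlinarith [norm_nonneg (x + y)]

/-- The map `1 + A`, as the bounded operator `(x, y) ↦ x + y` on the graph of `A`. -/
def oneAdd : S.A.graph →L[𝕜] H := (fst 𝕜 H H + snd 𝕜 H H) ∘L S.A.graph.subtypeL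

theorem antilipschitzWith_oneAdd : AntilipschitzWith 2 S.oneAdd :=
  S.oneAdd.antilipschitz_of_bound fun ⟨(x, y), hxy⟩ => by
    change max ‖x‖ ‖y‖ ≤ 2 * ‖x + y‖
    have hx := S.norm_le_norm_add hxy
    have hy : ‖y‖ ≤ ‖x + y‖ + ‖x‖ := by simpa using norm_sub_le (x + y) x
    exact max_le (by linarith [norm_nonneg x]) (by linarith)

theorem mem_graph_neg_of_forall_inner_eq_zero {y : H} (hy : ∀ p, inner 𝕜 y (S.oneAdd p) = 0) :
    (y, -y) ∈ S.A.graph := by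
  have hadj : ∀ x : S.A.domain, inner 𝕜 (-y) (x : H) = inner 𝕜 y (S.A x) := fun x => by
    have h : inner 𝕜 y ((x : H) + S.A x) = 0 := hy ⟨(x, S.A x), S.A.mem_graph x⟩
    rw [inner_add_right] at h
    rw [inner_neg_left, ← eq_neg_of_add_eq_zero_right h]
  have hdom := S.A.mem_adjoint_domain_of_exists y ⟨-y, hadj⟩
  rw [← LinearPMap.isSelfAdjoint_def.1 S.selfAdjoint]
  exact (LinearPMap.mem_graph_iff _).2
    ⟨⟨y, hdom⟩, rfl, LinearPMap.adjoint_apply_eq S.selfAdjoint.dense_domain _ hadj⟩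

theorem range_oneAdd : S.oneAdd.range = ⊤ := by
  have : CompleteSpace S.A.graph := S.selfAdjoint.isClosed.completeSpace_coe
  have : CompleteSpace S.oneAdd.range :=
    (S.antilipschitzWith_oneAdd.isClosed_range S.oneAdd.uniformContinuous).completeSpace_coe
  refine (Submodule.orthogonal_eq_bot_iff).1 ((Submodule.eq_bot_iff _).2 fun y hy => ?_)
  have hgraph := S.mem_graph_neg_of_forall_inner_eq_zero fun p =>
    (Submodule.mem_orthogonal' _ _).1 hy _ ⟨p, rfl⟩
  simpa using S.norm_le_norm_add hgraph

theorem neg_one_mem_resolventSet : (-1 : 𝕜) ∈ resolventSet S.A := by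
  have : CompleteSpace S.A.graph := S.selfAdjoint.isClosed.completeSpace_coe
  let Q := ContinuousLinearEquiv.ofBijective S.oneAdd
    (LinearMap.ker_eq_bot.2 S.antilipschitzWith_oneAdd.injective) S.range_oneAdd
  have hQ : ∀ p : S.A.graph, Q p = p.1.1 + p.1.2 := fun _ => rfl
  let R : H →L[𝕜] H := fst 𝕜 H H ∘L S.A.graph.subtypeL ∘L (Q.symm : H →L[𝕜] S.A.graph)
  have hR : ∀ u, R u = (Q.symm u).1.1 := fun _ => rfl
  refine ⟨-R, isResolventAt_neg_one_iff.2 fun x y => ⟨fun hxy => ?_, fun hxy => ?_⟩⟩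
  · rw [hR, ← hQ ⟨(x, y), hxy⟩, Q.symm_apply_apply]
  · have hsum := hQ (Q.symm (x + y))
    rw [Q.apply_symm_apply, ← hR, hxy, add_right_inj] at hsum
    rw [hsum]
    nth_rw 1 [← hxy]
    exact (Q.symm (x + y)).2

/-- The bounded operator `(1 + A)⁻¹`, that is, minus the resolvent at `-1`. -/
def invOneAdd : H →L[𝕜] H := -resolvent S.A (-1)

theorem mem_graph_iff {x y : H} : (x, y) ∈ S.A.graph ↔ S.invOneAdd (x + y) = x := by
  have h : IsResolventAt S.A (-1) (resolvent S.A (-1)) := by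
    rw [resolvent]
    exact (dif_pos S.neg_one_mem_resolventSet).symm ▸ S.neg_one_mem_resolventSet.choose_spec
  exact isResolventAt_neg_one_iff.1 (by rwa [invOneAdd, neg_neg]) x y

theorem mem_graph_invOneAdd (u : H) : (S.invOneAdd u, u - S.invOneAdd u) ∈ S.A.graph := by
  rw [mem_graph_iff, add_sub_cancel]

theorem sq_norm_invOneAdd_le (u : H) :
    ‖S.invOneAdd u‖ ^ 2 ≤ RCLike.re (inner 𝕜 u (S.invOneAdd u)) := by
  simpa using S.sq_norm_le_re_inner_add (S.mem_graph_invOneAdd u)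

theorem invOneAdd_injective : Function.Injective S.invOneAdd :=
  (injective_iff_map_eq_zero _).2 fun u hu => by
    have h := S.mem_graph_invOneAdd u
    rw [hu, sub_zero] at h
    exact LinearPMap.graph_fst_eq_zero_snd _ h rfl

theorem isSymmetric_invOneAdd : (S.invOneAdd : H →ₗ[𝕜] H).IsSymmetric := fun u v => by
  have h := S.inner_eq_of_mem_graph (S.mem_graph_invOneAdd u) (S.mem_graph_invOneAdd v)
  rw [inner_sub_left, inner_sub_right, sub_left_inj] at h
  exact h.symm

theorem mem_eigenspace_iff {t : ℝ} {x : H} :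
    x ∈ eigenspace S.A t ↔ ((1 + t : ℝ) : 𝕜) • S.invOneAdd x = x := by
  have hsum : x + (t : 𝕜) • x = ((1 + t : ℝ) : 𝕜) • x := by
    rw [RCLike.ofReal_add, RCLike.ofReal_one, add_smul, one_smul]
  rw [← map_smul, ← hsum, ← mem_graph_iff]
  rfl

theorem eigenspace_eq_bot_of_neg {t : ℝ} (ht : t < 0) : eigenspace S.A t = ⊥ := by
  refine (Submodule.eq_bot_iff _).2 fun x hx => ?_
  have h := S.inner_nonneg_of_mem_graph (x := x) (y := (t : 𝕜) • x) hx
  rw [inner_smul_left, RCLike.conj_ofReal, RCLike.re_ofReal_mul, ← norm_sq_eq_re_inner] at h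
  by_contra hx₀
  exact h.not_gt (mul_neg_of_neg_of_pos ht (pow_pos (norm_pos_iff.2 hx₀) 2))

theorem inner_eq_zero_of_mem_eigenspace {r s : ℝ} (hrs : r ≠ s) {x y : H}
    (hx : x ∈ eigenspace S.A r) (hy : y ∈ eigenspace S.A s) : inner 𝕜 x y = 0 := by
  have h := S.inner_eq_of_mem_graph (x := x) (x' := y) hx hy
  simp only [LinearMap.smul_apply, LinearMap.id_apply, inner_smul_left, inner_smul_right,
    RCLike.conj_ofReal] at h
  have hmul : (((r - s : ℝ)) : 𝕜) * inner 𝕜 x y = 0 := by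
    rw [RCLike.ofReal_sub, sub_mul, h, sub_self]
  exact (mul_eq_zero.1 hmul).resolve_left (RCLike.ofReal_ne_zero.2 (sub_ne_zero.2 hrs))

theorem orthogonalFamily_eigenspace :
    OrthogonalFamily 𝕜 (fun r : ℝ => eigenspace S.A r) fun r => (eigenspace S.A r).subtypeₗᵢ :=
  fun _ _ hrs x y => S.inner_eq_zero_of_mem_eigenspace hrs x.2 y.2

theorem exists_mem_eigenspace_of_hasEigenvector {μ : 𝕜} {x : H}
    (hx : Module.End.HasEigenvector (S.invOneAdd : Module.End 𝕜 H) μ x) :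
    ∃ t : ℝ, 0 ≤ t ∧ μ = ((1 + t : ℝ) : 𝕜)⁻¹ ∧ x ∈ eigenspace S.A t := by
  obtain ⟨r, rfl⟩ : ∃ r : ℝ, μ = r := ⟨RCLike.re μ, (RCLike.conj_eq_iff_re.1 <|
    S.isSymmetric_invOneAdd.conj_eigenvalue_eq_self <|
      Module.End.hasEigenvalue_of_hasEigenvector hx).symm⟩
  have hRx : S.invOneAdd x = (r : 𝕜) • x := hx.apply_eq_smul
  have hx₀ : 0 < ‖x‖ := norm_pos_iff.2 hx.2
  have hr₀ : r ≠ 0 := by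
    rintro rfl
    exact hx.2 (S.invOneAdd_injective (by simpa using hRx))
  have hr : r ^ 2 * ‖x‖ ^ 2 ≤ r * ‖x‖ ^ 2 := by
    have h := S.sq_norm_invOneAdd_le x
    rwa [hRx, inner_smul_right, RCLike.re_ofReal_mul, ← norm_sq_eq_re_inner, norm_smul, mul_pow,
      RCLike.norm_ofReal, sq_abs] at h
  have hr_le : r ^ 2 ≤ r := le_of_mul_le_mul_right hr (by positivity)
  have hr_pos : 0 < r := hr₀.symm.lt_of_le ((sq_nonneg r).trans hr_le)
  refine ⟨r⁻¹ - 1, sub_nonneg.2 ((one_le_inv₀ hr_pos).2 (by nlinarith)), by simp, ?_⟩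
  rw [mem_eigenspace_iff, hRx, smul_smul, add_sub_cancel, RCLike.ofReal_inv,
    inv_mul_cancel₀ (RCLike.ofReal_ne_zero.2 hr₀), one_smul]

end SpectralStructure

end Resolvent

section CompactOperator

variable {𝕜 : Type*} [RCLike 𝕜]

theorem finiteDimensional_of_isCompactOperator_of_antilipschitzWith {E F : Type*}
    [NormedAddCommGroup E] [NormedSpace 𝕜 E] [CompleteSpace E] [NormedAddCommGroup F]
    [NormedSpace 𝕜 F] {K : E →L[𝕜] F} (hK : IsCompactOperator K) {c : NNReal}
    (hc : AntilipschitzWith c K) : FiniteDimensional 𝕜 E := by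
  obtain ⟨C, hC, hmem⟩ := hK
  exact .of_isCompactOperator_id
    ⟨K ⁻¹' C, (hc.isClosedEmbedding K.uniformContinuous).isCompact_preimage hC, hmem⟩

variable {H : Type*} [NormedAddCommGroup H] [InnerProductSpace 𝕜 H] [CompleteSpace H]

theorem opNorm_le_of_forall_hasEigenvalue {K : H →L[𝕜] H} (hK : IsCompactOperator K)
    (hsymm : (K : H →ₗ[𝕜] H).IsSymmetric) {c : ℝ} (hc : 0 ≤ c)
    (h : ∀ μ, Module.End.HasEigenvalue (K : Module.End 𝕜 H) μ → ‖μ‖ ≤ c) : ‖K‖ ≤ c := by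
  lift c to NNReal using hc
  have hrad : spectralRadius 𝕜 K ≤ c := iSup₂_le fun μ hμ => by
    rcases eq_or_ne μ 0 with rfl | hμ₀
    · simp
    · exact_mod_cast h μ ((hK.hasEigenvalue_iff_mem_spectrum hμ₀).2 hμ)
  rw [K.spectralRadius_eq_nnnorm (isSelfAdjoint_iff_isSymmetric.2 hsymm)] at hrad
  exact_mod_cast hrad

end CompactOperator

section Sublevel

variable {𝕜 : Type*} [RCLike 𝕜] {H : Type*} [NormedAddCommGroup H] [InnerProductSpace 𝕜 H]

/-- The span of the eigenvectors of `A` for the eigenvalues `≤ t`, whose dimension counts these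
eigenvalues with multiplicity. -/
def sublevelSpace (A : H →ₗ.[𝕜] H) (t : ℝ) : Submodule 𝕜 H :=
  ⨆ r : ℝ, ⨆ _ : r ≤ t, eigenspace A r

variable {A : H →ₗ.[𝕜] H}

theorem eigenspace_le_sublevelSpace {r t : ℝ} (hrt : r ≤ t) :
    eigenspace A r ≤ sublevelSpace A t :=
  le_iSup₂_of_le r hrt le_rfl

theorem sublevelSpace_mono : Monotone (sublevelSpace A) := fun _ _ hst =>
  iSup₂_le fun _ hr => eigenspace_le_sublevelSpace (hr.trans hst)

theorem kthEigenvalue_le {k : ℕ} {t : ℝ} (hk : (k : Cardinal) ≤ Module.rank 𝕜 (sublevelSpace A t)) :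
    kthEigenvalue A k ≤ t :=
  sInf_le ⟨t, rfl, hk⟩

theorem exists_le_rank_sublevelSpace_of_kthEigenvalue_lt {k : ℕ} {s : EReal}
    (hs : kthEigenvalue A k < s) :
    ∃ t : ℝ, (t : EReal) < s ∧ (k : Cardinal) ≤ Module.rank 𝕜 (sublevelSpace A t) := by
  obtain ⟨_, ⟨t, rfl, hk⟩, hts⟩ := sInf_lt_iff.1 hs
  exact ⟨t, hts, hk⟩

namespace SpectralStructure

variable [CompleteSpace H] (S : SpectralStructure 𝕜 H)

theorem sublevelSpace_eq_bot_of_neg {t : ℝ} (ht : t < 0) : sublevelSpace S.A t = ⊥ :=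
  eq_bot_iff.2 <| iSup₂_le fun _ hr => (S.eigenspace_eq_bot_of_neg (hr.trans_lt ht)).le

theorem kthEigenvalue_nonneg {k : ℕ} (hk : 1 ≤ k) : 0 ≤ kthEigenvalue S.A k := by
  refine le_sInf ?_
  rintro _ ⟨t, rfl, ht⟩
  by_contra! hlt
  change (k : Cardinal) ≤ Module.rank 𝕜 (sublevelSpace S.A t) at ht
  rw [S.sublevelSpace_eq_bot_of_neg (EReal.coe_lt_coe_iff.1 hlt), rank_bot] at ht
  exact hk.not_gt (Nat.cast_lt.1 (ht.trans_lt (by simp)))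

variable {S}

theorem invOneAdd_mem_eigenspace {r : ℝ} {x : H} (hx : x ∈ eigenspace S.A r) :
    S.invOneAdd x ∈ eigenspace S.A r := by
  rw [mem_eigenspace_iff] at hx ⊢
  rw [← map_smul, hx]

theorem norm_le_of_mem_eigenspace {r t : ℝ} (hrt : r ≤ t) {x : H} (hx : x ∈ eigenspace S.A r) :
    ‖x‖ ≤ (1 + t) * ‖S.invOneAdd x‖ := by
  rcases lt_or_ge r 0 with hr | hr
  · rw [S.eigenspace_eq_bot_of_neg hr, Submodule.mem_bot] at hx
    simp [hx]
  · calc ‖x‖ = (1 + r) * ‖S.invOneAdd x‖ := by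
          conv_lhs => rw [← S.mem_eigenspace_iff.1 hx, norm_smul,
            RCLike.norm_of_nonneg (by positivity)]
      _ ≤ (1 + t) * ‖S.invOneAdd x‖ := by gcongr

theorem norm_le_of_mem_sublevelSpace {t : ℝ} {x : H} (hx : x ∈ sublevelSpace S.A t) :
    ‖x‖ ≤ (1 + t) * ‖S.invOneAdd x‖ := by
  rcases lt_or_ge t 0 with ht | ht
  · rw [S.sublevelSpace_eq_bot_of_neg ht, Submodule.mem_bot] at hx
    simp [hx]
  rw [sublevelSpace, iSup_subtype', Submodule.mem_iSup_iff_exists_finsupp] at hx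
  obtain ⟨l, hl, rfl⟩ := hx
  have hsq := (S.orthogonalFamily_eigenspace.comp
    (Subtype.val_injective (p := fun r : ℝ => r ≤ t))).norm_sum
  have hx : ‖∑ r ∈ l.support, l r‖ ^ 2 = ∑ r ∈ l.support, ‖l r‖ ^ 2 :=
    hsq (fun r => ⟨l r, hl r⟩) _
  have hRx : ‖∑ r ∈ l.support, S.invOneAdd (l r)‖ ^ 2 =
      ∑ r ∈ l.support, ‖S.invOneAdd (l r)‖ ^ 2 :=
    hsq (fun r => ⟨S.invOneAdd (l r), invOneAdd_mem_eigenspace (hl r)⟩) _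
  refine le_of_sq_le_sq ?_ (by positivity)
  rw [Finsupp.sum, map_sum, mul_pow, hx, hRx, Finset.mul_sum]
  refine Finset.sum_le_sum fun r _ => ?_
  rw [← mul_pow]
  gcongr
  exact norm_le_of_mem_eigenspace r.2 (hl r)

theorem invOneAdd_mem_sublevelSpace {t : ℝ} {x : H} (hx : x ∈ sublevelSpace S.A t) :
    S.invOneAdd x ∈ sublevelSpace S.A t := by
  have h : sublevelSpace S.A t ≤ (sublevelSpace S.A t).comap (S.invOneAdd : H →ₗ[𝕜] H) :=
    iSup₂_le fun r hr _ hx => eigenspace_le_sublevelSpace hr (invOneAdd_mem_eigenspace hx)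
  exact h hx

variable (hS : IsCompactOperator S.invOneAdd)

include hS

theorem norm_invOneAdd_apply_le_of_mem_orthogonal {t : ℝ} (ht : 0 ≤ t) {x : H}
    (hx : x ∈ (sublevelSpace S.A t)ᗮ) : ‖S.invOneAdd x‖ ≤ (1 + t)⁻¹ * ‖x‖ := by
  have hinv : ∀ v ∈ (sublevelSpace S.A t)ᗮ, S.invOneAdd v ∈ (sublevelSpace S.A t)ᗮ :=
    S.isSymmetric_invOneAdd.orthogonalComplement_mem_invtSubmodule
      (p := sublevelSpace S.A t) fun _ => invOneAdd_mem_sublevelSpace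
  have hnorm : ‖S.invOneAdd.restrict hinv‖ ≤ (1 + t)⁻¹ := by
    refine opNorm_le_of_forall_hasEigenvalue
      (IsCompactOperator.restrict' (f := (S.invOneAdd : H →ₗ[𝕜] H)) hS hinv)
      (S.isSymmetric_invOneAdd.restrict_invariant hinv) (by positivity) fun μ hμ => ?_
    obtain ⟨v, hv⟩ := hμ.exists_hasEigenvector
    have hv₀ : (v : H) ≠ 0 := Submodule.coe_eq_zero.not.2 hv.2
    obtain ⟨s, hs, rfl, hvs⟩ := S.exists_mem_eigenspace_of_hasEigenvector (x := v)
      ⟨Module.End.mem_eigenspace_iff.2 (congrArg Subtype.val hv.apply_eq_smul), hv₀⟩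
    have hts : t < s := by
      by_contra! hst
      exact hv₀ (inner_self_eq_zero.1 (v.2 v (eigenspace_le_sublevelSpace hst hvs)))
    rw [norm_inv, RCLike.norm_of_nonneg (by positivity)]
    gcongr
  exact (S.invOneAdd.restrict hinv).le_of_opNorm_le hnorm ⟨x, hx⟩

theorem finiteDimensional_sublevelSpace (t : ℝ) : FiniteDimensional 𝕜 (sublevelSpace S.A t) := by
  have hle : ∀ x ∈ (sublevelSpace S.A t).topologicalClosure, ‖x‖ ≤ (1 + t) * ‖S.invOneAdd x‖ :=
    closure_minimal (fun _ => norm_le_of_mem_sublevelSpace)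
      (isClosed_le continuous_norm (by fun_prop))
  have hanti : AntilipschitzWith (1 + t).toNNReal
      (S.invOneAdd ∘L (sublevelSpace S.A t).topologicalClosure.subtypeL) :=
    antilipschitz_of_bound _ fun x => (hle x x.2).trans
      (mul_le_mul_of_nonneg_right (Real.le_coe_toNNReal _) (norm_nonneg _))
  have := finiteDimensional_of_isCompactOperator_of_antilipschitzWith (hS.comp_clm _) hanti
  exact Submodule.finiteDimensional_of_le (Submodule.le_topologicalClosure _)

theorem orthogonal_iSup_sublevelSpace_eq_bot : (⨆ t, sublevelSpace S.A t)ᗮ = ⊥ := by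
  refine eq_bot_iff.2 <| (Submodule.orthogonal_le <| iSup_le fun μ x hx => ?_).trans
    (orthogonalComplement_iSup_eigenspaces_eq_bot hS S.isSymmetric_invOneAdd).le
  rcases eq_or_ne x 0 with rfl | hx₀
  · exact zero_mem _
  · obtain ⟨t, -, -, ht⟩ := S.exists_mem_eigenspace_of_hasEigenvector ⟨hx, hx₀⟩
    exact Submodule.mem_iSup_of_mem t (eigenspace_le_sublevelSpace le_rfl ht)

theorem kthEigenvalue_lt_top {k : ℕ} (hk : (k : Cardinal) ≤ Module.rank 𝕜 H) :
    kthEigenvalue S.A k < ⊤ := by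
  have hfin := finiteDimensional_sublevelSpace hS
  suffices h : ∃ t, (k : Cardinal) ≤ Module.rank 𝕜 (sublevelSpace S.A t) by
    obtain ⟨t, ht⟩ := h
    exact (kthEigenvalue_le ht).trans_lt (EReal.coe_lt_top t)
  by_contra! hlt
  have hbdd : BddAbove (Set.range fun t => Module.finrank 𝕜 (sublevelSpace S.A t)) := by
    refine ⟨k, ?_⟩
    rintro _ ⟨t, rfl⟩
    exact Module.finrank_le_of_rank_le (hlt t).le
  obtain ⟨t₀, ht₀⟩ := Nat.sSup_mem (Set.range_nonempty _) hbdd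
  have hle : ∀ t, sublevelSpace S.A t ≤ sublevelSpace S.A t₀ := fun t => by
    have hmax : sublevelSpace S.A t₀ = sublevelSpace S.A (max t t₀) :=
      Submodule.eq_of_le_of_finrank_le (sublevelSpace_mono (le_max_right t t₀))
        ((le_csSup hbdd ⟨_, rfl⟩).trans ht₀.ge)
    exact hmax ▸ sublevelSpace_mono (le_max_left t t₀)
  have htop : sublevelSpace S.A t₀ = ⊤ := Submodule.orthogonal_eq_bot_iff.1 <| eq_bot_iff.2 <|
    (Submodule.orthogonal_le (iSup_le hle)).trans (orthogonal_iSup_sublevelSpace_eq_bot hS).le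
  have hlt₀ := hlt t₀
  rw [htop, rank_top] at hlt₀
  exact hk.not_gt hlt₀

theorem sublevelSpace_le_span {φ : ℕ → H}
    (hφ : Orthonormal 𝕜 fun k : dimIndices 𝕜 H => φ k)
    (hmem : ∀ k ∈ dimIndices 𝕜 H, ∃ t : ℝ, kthEigenvalue S.A k = t ∧ φ k ∈ eigenspace S.A t)
    (t : ℝ) : sublevelSpace S.A t ≤ Submodule.span 𝕜 (φ '' dimIndices 𝕜 H) := by
  have hfin := finiteDimensional_sublevelSpace hS t
  let I := Finset.Icc 1 (Module.finrank 𝕜 (sublevelSpace S.A t))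
  have hrank : ∀ k ∈ I, (k : Cardinal) ≤ Module.rank 𝕜 (sublevelSpace S.A t) := fun k hk => by
    rw [← Module.finrank_eq_rank]
    exact_mod_cast (Finset.mem_Icc.1 hk).2
  have hI : ∀ k ∈ I, k ∈ dimIndices 𝕜 H := fun k hk =>
    ⟨(Finset.mem_Icc.1 hk).1, (hrank k hk).trans (Submodule.rank_le _)⟩
  have hle : Submodule.span 𝕜 (Set.range fun k : I => φ k) ≤ sublevelSpace S.A t := by
    rw [Submodule.span_le]
    rintro _ ⟨k, rfl⟩
    obtain ⟨s, hs, hks⟩ := hmem k (hI k k.2)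
    have hst := kthEigenvalue_le (hrank k k.2)
    rw [hs, EReal.coe_le_coe_iff] at hst
    exact eigenspace_le_sublevelSpace hst hks
  have hindep : LinearIndependent 𝕜 fun k : I => φ k :=
    (hφ.comp (fun k : I => ⟨k, hI k k.2⟩) fun _ _ h => by
      simpa only [Subtype.mk.injEq, SetCoe.ext_iff] using h).linearIndependent
  rw [← Submodule.eq_of_le_of_finrank_le hle (by simp [finrank_span_eq_card hindep, I])]
  refine Submodule.span_mono ?_
  rintro _ ⟨k, rfl⟩
  exact ⟨k, hI k k.2, rfl⟩

theorem isOrthonormalEigenbasis_of_orthonormal {φ : ℕ → H}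
    (hφ : Orthonormal 𝕜 fun k : dimIndices 𝕜 H => φ k)
    (hmem : ∀ k ∈ dimIndices 𝕜 H, ∃ t : ℝ, kthEigenvalue S.A k = t ∧ φ k ∈ eigenspace S.A t) :
    IsOrthonormalEigenbasis S.A φ := by
  refine ⟨hφ, (Submodule.topologicalClosure_eq_top_iff).2 <| eq_bot_iff.2 ?_, hmem⟩
  exact (Submodule.orthogonal_le (iSup_le (sublevelSpace_le_span hS hφ hmem))).trans
    (orthogonal_iSup_sublevelSpace_eq_bot hS).le

end SpectralStructure

end Sublevel

namespace SpectralStructure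

section Comparison

variable {𝕜 : Type*} [RCLike 𝕜] {H : Type*} [NormedAddCommGroup H] [InnerProductSpace 𝕜 H]
  [CompleteSpace H] {G : Type*} [NormedAddCommGroup G] [InnerProductSpace 𝕜 G] [CompleteSpace G]
  {S : SpectralStructure 𝕜 H} {S' : SpectralStructure 𝕜 G} {L : H →L[𝕜] G} {a b : ℝ}

theorem eq_zero_of_mem_sublevelSpace_of_apply_mem_orthogonal
    (hS' : IsCompactOperator S'.invOneAdd) (hL : ‖L‖ ≤ 1) (ha : 0 ≤ a) (hab : a < b)
    (hsub : ‖S.invOneAdd - adjoint L ∘L S'.invOneAdd ∘L L‖ < (1 + a)⁻¹ - (1 + b)⁻¹) {x : H}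
    (hx : x ∈ sublevelSpace S.A a) (hLx : L x ∈ (sublevelSpace S'.A b)ᗮ) : x = 0 := by
  have hlower : (1 + a)⁻¹ * ‖x‖ ≤ ‖S.invOneAdd x‖ :=
    (inv_mul_le_iff₀ (by positivity)).2 (norm_le_of_mem_sublevelSpace hx)
  have hupper : ‖adjoint L (S'.invOneAdd (L x))‖ ≤ (1 + b)⁻¹ * ‖x‖ := calc
    _ ≤ ‖S'.invOneAdd (L x)‖ := by
      simpa using (adjoint L).le_of_opNorm_le ((norm_map adjoint L).trans_le hL) _
    _ ≤ (1 + b)⁻¹ * ‖L x‖ :=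
      norm_invOneAdd_apply_le_of_mem_orthogonal hS' (ha.trans hab.le) hLx
    _ ≤ (1 + b)⁻¹ * ‖x‖ := by
      have hb : 0 ≤ b := ha.trans hab.le
      gcongr
      simpa using L.le_of_opNorm_le hL x
  have herr := (S.invOneAdd - adjoint L ∘L S'.invOneAdd ∘L L).le_opNorm x
  rw [sub_apply, comp_apply, comp_apply] at herr
  have hsplit := norm_le_insert' (S.invOneAdd x) (adjoint L (S'.invOneAdd (L x)))
  by_contra hx₀
  nlinarith [norm_pos_iff.2 hx₀]

theorem natCast_le_rank_sublevelSpace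
    (hS' : IsCompactOperator S'.invOneAdd) (hL : ‖L‖ ≤ 1) (ha : 0 ≤ a) (hab : a < b)
    (hsub : ‖S.invOneAdd - adjoint L ∘L S'.invOneAdd ∘L L‖ < (1 + a)⁻¹ - (1 + b)⁻¹) {k : ℕ}
    (hk : (k : Cardinal) ≤ Module.rank 𝕜 (sublevelSpace S.A a)) :
    (k : Cardinal) ≤ Module.rank 𝕜 (sublevelSpace S'.A b) := by
  have hfin := finiteDimensional_sublevelSpace hS' b
  let Q : sublevelSpace S.A a →ₗ[𝕜] sublevelSpace S'.A b :=
    (sublevelSpace S'.A b).orthogonalProjectionOnto ∘L L ∘L (sublevelSpace S.A a).subtypeL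
  have hQ : Function.Injective Q := (injective_iff_map_eq_zero Q).2 fun x hx =>
    Subtype.ext <| eq_zero_of_mem_sublevelSpace_of_apply_mem_orthogonal hS' hL ha hab hsub x.2 <|
      Submodule.orthogonalProjectionOnto_eq_zero_iff.1 hx
  exact Cardinal.nat_le_lift_iff.1 <|
    (Cardinal.nat_le_lift_iff.2 hk).trans (LinearMap.lift_rank_le_of_injective Q hQ)

theorem kthEigenvalue_le_of_norm_sub_lt
    (hS' : IsCompactOperator S'.invOneAdd) (hL : ‖L‖ ≤ 1) (ha : 0 ≤ a) (hab : a < b)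
    (hsub : ‖S.invOneAdd - adjoint L ∘L S'.invOneAdd ∘L L‖ < (1 + a)⁻¹ - (1 + b)⁻¹) {k : ℕ}
    (hk : kthEigenvalue S.A k < a) : kthEigenvalue S'.A k ≤ b := by
  obtain ⟨t, hta, ht⟩ := exists_le_rank_sublevelSpace_of_kthEigenvalue_lt hk
  exact kthEigenvalue_le <| natCast_le_rank_sublevelSpace hS' hL ha hab hsub <|
    ht.trans (Submodule.rank_mono (sublevelSpace_mono (EReal.coe_lt_coe_iff.1 hta).le))

end Comparison

section Convergence

variable {𝕜 : Type*} [RCLike 𝕜] {ι : Type*} {F : Filter ι}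
  {H : Type*} [NormedAddCommGroup H] [InnerProductSpace 𝕜 H] [CompleteSpace H]
  {E : ι → Type*} [∀ α, NormedAddCommGroup (E α)] [∀ α, InnerProductSpace 𝕜 (E α)]
  [∀ α, CompleteSpace (E α)] {T : ∀ α, H →L[𝕜] E α}
  {S : ∀ α, SpectralStructure 𝕜 (E α)} {S₀ : SpectralStructure 𝕜 H}

theorem tendsto_kthEigenvalue (hT : IsAsymptoticIsometry F T)
    (hS₀ : IsCompactOperator S₀.invOneAdd) (hS : ∀ α, IsCompactOperator (S α).invOneAdd)
    (h : Tendsto (fun α => ‖(S α).invOneAdd - T α ∘L S₀.invOneAdd ∘L adjoint (T α)‖) F (𝓝 0))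
    (h' : Tendsto (fun α => ‖S₀.invOneAdd - adjoint (T α) ∘L (S α).invOneAdd ∘L T α‖) F (𝓝 0))
    {k : ℕ} (hk : 1 ≤ k) :
    Tendsto (fun α => kthEigenvalue (S α).A k) F (𝓝 (kthEigenvalue S₀.A k)) := by
  have hgap : ∀ {a b : ℝ}, 0 ≤ a → a < b → 0 < (1 + a)⁻¹ - (1 + b)⁻¹ := fun ha hab =>
    sub_pos.2 (inv_strictAnti₀ (by positivity) (by linarith))
  refine tendsto_order.2 ⟨fun s hs => ?_, fun s hs => ?_⟩
  · rcases lt_or_ge s 0 with hs₀ | hs₀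
    · exact .of_forall fun α => hs₀.trans_le ((S α).kthEigenvalue_nonneg hk)
    obtain ⟨b, hsb, hb⟩ := EReal.lt_iff_exists_real_btwn.1 hs
    obtain ⟨a, hsa, hab⟩ := EReal.lt_iff_exists_real_btwn.1 hsb
    have ha : 0 ≤ a := EReal.coe_nonneg.1 (hs₀.trans hsa.le)
    rw [EReal.coe_lt_coe_iff] at hab
    filter_upwards [h.eventually_lt_const (hgap ha hab)] with α hα
    by_contra! hle
    refine hb.not_ge <| kthEigenvalue_le_of_norm_sub_lt (L := adjoint (T α)) hS₀
      ((norm_map adjoint (T α)).trans_le (hT.norm_le_one α)) ha hab ?_ (hle.trans_lt hsa)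
    rwa [adjoint_adjoint]
  · obtain ⟨a, hka, has⟩ := EReal.lt_iff_exists_real_btwn.1 hs
    obtain ⟨b, hab, hbs⟩ := EReal.lt_iff_exists_real_btwn.1 has
    have ha : 0 ≤ a := EReal.coe_nonneg.1 ((S₀.kthEigenvalue_nonneg hk).trans hka.le)
    rw [EReal.coe_lt_coe_iff] at hab
    filter_upwards [h'.eventually_lt_const (hgap ha hab)] with α hα
    exact (kthEigenvalue_le_of_norm_sub_lt (hS α) (hT.norm_le_one α) ha hab hα hka).trans_lt hbs

theorem eventually_mem_dimIndices {k : ℕ} (hk : 1 ≤ k)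
    (hlim : Tendsto (fun α => kthEigenvalue (S α).A k) F (𝓝 (kthEigenvalue S₀.A k)))
    (hlt : kthEigenvalue S₀.A k < ⊤) : ∀ᶠ α in F, k ∈ dimIndices 𝕜 (E α) := by
  filter_upwards [hlim.eventually_lt_const hlt] with α hα
  obtain ⟨t, -, ht⟩ := exists_le_rank_sublevelSpace_of_kthEigenvalue_lt hα
  exact ⟨hk, ht.trans (Submodule.rank_le _)⟩

end Convergence

section Eigenvectors

variable {𝕜 : Type*} [RCLike 𝕜] {ι : Type*} {U : Ultrafilter ι}
  {H : Type*} [NormedAddCommGroup H] [InnerProductSpace 𝕜 H] [CompleteSpace H]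
  {E : ι → Type*} [∀ α, NormedAddCommGroup (E α)] [∀ α, InnerProductSpace 𝕜 (E α)]
  [∀ α, CompleteSpace (E α)] {T : ∀ α, H →L[𝕜] E α}

theorem exists_stronglyTendsto_apply (hT : IsAsymptoticIsometry U T) {R : ∀ α, E α →L[𝕜] E α}
    {R₀ : H →L[𝕜] H} (hR₀ : IsCompactOperator R₀)
    (h : Tendsto (fun α => ‖R α - T α ∘L R₀ ∘L adjoint (T α)‖) U (𝓝 0)) {u : ∀ α, E α} {B : ℝ}
    (hu : ∀ᶠ α in U, ‖u α‖ ≤ B) : ∃ y, Tendsto (fun α => R₀ (adjoint (T α) (u α))) U (𝓝 y) ∧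
      StronglyTendsto U T (fun α => R α (u α)) y := by
  have hmem : ∀ᶠ α in U, R₀ (adjoint (T α) (u α)) ∈ closure (R₀ '' Metric.closedBall 0 B) :=
    hu.mono fun α hα =>
      subset_closure ⟨_, by simpa using (hT.norm_adjoint_apply_le α _).trans hα, rfl⟩
  obtain ⟨y, -, hy⟩ := (hR₀.isCompact_closure_image_closedBall B).ultrafilter_le_nhds'
    (U.map _) hmem
  refine ⟨y, hy, squeeze_zero' (.of_forall fun _ => norm_nonneg _) ?_ <| by
    simpa using (h.mul_const B).add (tendsto_iff_norm_sub_tendsto_zero.1 hy)⟩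
  filter_upwards [hu] with α hα
  have hsplit : R α (u α) - T α y = (R α - T α ∘L R₀ ∘L adjoint (T α)) (u α) +
      T α (R₀ (adjoint (T α) (u α)) - y) := by
    simp
  rw [hsplit]
  exact (norm_add_le _ _).trans
    (add_le_add (le_of_opNorm_le_of_le _ le_rfl hα) (hT.norm_apply_le α _))

variable {S : ∀ α, SpectralStructure 𝕜 (E α)} {S₀ : SpectralStructure 𝕜 H}

theorem exists_mem_eigenspace_stronglyTendsto (hT : IsAsymptoticIsometry U T)
    (hS₀ : IsCompactOperator S₀.invOneAdd)
    (h : Tendsto (fun α => ‖(S α).invOneAdd - T α ∘L S₀.invOneAdd ∘L adjoint (T α)‖) U (𝓝 0))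
    {t : ι → ℝ} {t₀ : ℝ} (ht : Tendsto t U (𝓝 t₀)) {u : ∀ α, E α} {B : ℝ}
    (huB : ∀ᶠ α in U, ‖u α‖ ≤ B) (hu : ∀ᶠ α in U, u α ∈ eigenspace (S α).A (t α)) :
    ∃ w ∈ eigenspace S₀.A t₀, StronglyTendsto U T u w := by
  obtain ⟨y, hy, hRu⟩ := exists_stronglyTendsto_apply hT hS₀ h huB
  have hw : StronglyTendsto U T u (((1 + t₀ : ℝ) : 𝕜) • y) := by
    refine (hT.stronglyTendsto_smul
      ((RCLike.continuous_ofReal.tendsto _).comp (ht.const_add 1)) hRu).congr' ?_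
    filter_upwards [hu] with α hα
    rw [Function.comp_apply, (S α).mem_eigenspace_iff.1 hα]
  have hRw : S₀.invOneAdd (((1 + t₀ : ℝ) : 𝕜) • y) = y := tendsto_nhds_unique
    ((S₀.invOneAdd.continuous.tendsto _).comp (hT.tendsto_adjoint_of_stronglyTendsto hw)) hy
  exact ⟨_, S₀.mem_eigenspace_iff.2 (by rw [hRw]), hw⟩

variable {φ : ∀ α, ℕ → E α}

theorem exists_kthEigenvector_stronglyTendsto (hT : IsAsymptoticIsometry U T)
    (hS₀ : IsCompactOperator S₀.invOneAdd)
    (h : Tendsto (fun α => ‖(S α).invOneAdd - T α ∘L S₀.invOneAdd ∘L adjoint (T α)‖) U (𝓝 0))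
    (hφ : ∀ α, IsOrthonormalEigenbasis (S α).A (φ α)) {k : ℕ} (hk : k ∈ dimIndices 𝕜 H)
    (hlim : Tendsto (fun α => kthEigenvalue (S α).A k) U (𝓝 (kthEigenvalue S₀.A k))) :
    ∃ w, (∃ t : ℝ, kthEigenvalue S₀.A k = t ∧ w ∈ eigenspace S₀.A t) ∧
      StronglyTendsto U T (fun α => φ α k) w := by
  have hlt := kthEigenvalue_lt_top hS₀ hk.2
  have hbot : kthEigenvalue S₀.A k ≠ ⊥ :=
    (EReal.bot_lt_zero.trans_le (S₀.kthEigenvalue_nonneg hk.1)).ne'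
  have hmem := eventually_mem_dimIndices hk.1 hlim hlt
  obtain ⟨w, hw, hφw⟩ := exists_mem_eigenspace_stronglyTendsto hT hS₀ h
    (t := fun α => (kthEigenvalue (S α).A k).toReal)
    ((EReal.tendsto_toReal hlt.ne hbot).comp hlim)
    (hmem.mono fun α hα => ((hφ α).1.1 ⟨k, hα⟩).le) <| hmem.mono fun α hα => by
      obtain ⟨t, ht, hφt⟩ := (hφ α).2.2 k hα
      rwa [ht, EReal.toReal_coe]
  exact ⟨w, ⟨_, (EReal.coe_toReal hlt.ne hbot).symm, hw⟩, hφw⟩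

theorem exists_isOrthonormalEigenbasis_stronglyTendsto (hT : IsAsymptoticIsometry U T)
    (hS₀ : IsCompactOperator S₀.invOneAdd)
    (h : Tendsto (fun α => ‖(S α).invOneAdd - T α ∘L S₀.invOneAdd ∘L adjoint (T α)‖) U (𝓝 0))
    (hφ : ∀ α, IsOrthonormalEigenbasis (S α).A (φ α))
    (hlim : ∀ k : ℕ, 1 ≤ k →
      Tendsto (fun α => kthEigenvalue (S α).A k) U (𝓝 (kthEigenvalue S₀.A k))) :
    ∃ φ₀, IsOrthonormalEigenbasis S₀.A φ₀ ∧
      ∀ k ∈ dimIndices 𝕜 H, StronglyTendsto U T (fun α => φ α k) (φ₀ k) := by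
  choose! φ₀ hφ₀ hφ₀_lim using fun (k : ℕ) (hk : k ∈ dimIndices 𝕜 H) =>
    exists_kthEigenvector_stronglyTendsto hT hS₀ h hφ hk (hlim k hk.1)
  refine ⟨φ₀, isOrthonormalEigenbasis_of_orthonormal hS₀ ?_ hφ₀, hφ₀_lim⟩
  have hmem : ∀ k ∈ dimIndices 𝕜 H, ∀ᶠ α in U, k ∈ dimIndices 𝕜 (E α) := fun k hk =>
    eventually_mem_dimIndices hk.1 (hlim k hk.1) (kthEigenvalue_lt_top hS₀ hk.2)
  classical
  refine orthonormal_iff_ite.2 fun k l => ?_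
  refine tendsto_nhds_unique (hT.tendsto_inner (hφ₀_lim k k.2) (hφ₀_lim l l.2))
    (tendsto_const_nhds.congr' ?_)
  filter_upwards [hmem k k.2, hmem l l.2] with α hk hl
  simpa [Subtype.ext_iff] using (orthonormal_iff_ite.1 (hφ α).1 ⟨k, hk⟩ ⟨l, hl⟩).symm

end Eigenvectors

end SpectralStructure

section Subnets

theorem exists_monotone_tendsto_of_le_atTop {ι : Type u} [Preorder ι] {G : Filter ι} [G.NeBot]
    (hG : G ≤ atTop) :
    ∃ (κ : Type u) (_ : Preorder κ) (_ : IsDirectedOrder κ) (_ : Nonempty κ) (h : κ → ι),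
      Monotone h ∧ Tendsto h atTop G := by
  let κ : Type u := {p : Set ι × ι // p.1 ∈ G ∧ p.2 ∈ p.1}
  let _ : Preorder κ := Preorder.lift fun p => (OrderDual.toDual p.1.1, p.1.2)
  have hκ : ∀ s ∈ G, ∃ p : κ, p.1.1 = s := fun s hs =>
    let ⟨a, ha⟩ := G.nonempty_of_mem hs
    ⟨⟨(s, a), hs, ha⟩, rfl⟩
  refine ⟨κ, inferInstance, ⟨fun p q => ?_⟩, (hκ _ univ_mem).nonempty, fun p => p.1.2,
    fun p q hpq => hpq.2, fun s hs => ?_⟩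
  · have hpq : p.1.1 ∩ q.1.1 ∈ G := inter_mem p.2.1 q.2.1
    obtain ⟨a, ha, hpa, hqa⟩ := G.nonempty_of_mem
      (inter_mem hpq (hG (inter_mem (Ici_mem_atTop p.1.2) (Ici_mem_atTop q.1.2))))
    exact ⟨⟨(p.1.1 ∩ q.1.1, a), hpq, ha⟩, ⟨Set.inter_subset_left, hpa⟩,
      ⟨Set.inter_subset_right, hqa⟩⟩
  · obtain ⟨p, rfl⟩ := hκ s hs
    exact mem_map.2 ((eventually_ge_atTop p).mono fun q hq => hq.1 q.2.2)

theorem tendsto_natFloor_inv_atTop {ι : Type*} {F : Filter ι} {ε : ι → ℝ} (hε : ∀ α, 0 < ε α)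
    (hε₀ : Tendsto ε F (𝓝 0)) : Tendsto (fun α => ⌊(ε α)⁻¹⌋₊) F atTop :=
  tendsto_nat_floor_atTop.comp <| tendsto_inv_nhdsGT_zero.comp <|
    tendsto_nhdsWithin_iff.2 ⟨hε₀, .of_forall hε⟩

end Subnets

section ContinuousFunctions

variable {𝕜 : Type*} [RCLike 𝕜] {X : Type*} [MeasurableSpace X] {m : Measure X}
  [IsFiniteMeasure m] {Y : Type*} [TopologicalSpace Y] [CompactSpace Y] [MeasurableSpace Y]
  [OpensMeasurableSpace Y] {f : X → Y}

theorem memLp_comp (hf : AEMeasurable f m) (v : C(Y, 𝕜)) (p : ℝ≥0∞) :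
    MemLp (fun x => v (f x)) p m :=
  MemLp.of_bound (v.continuous.measurable.comp_aemeasurable hf).aestronglyMeasurable ‖v‖
    (.of_forall fun x => v.norm_coe_le_norm (f x))

/-- The linear map `v ↦ v ∘ f` from continuous functions on `Y` to `L²(X)`. For `f = id` it is the
canonical map from continuous functions to `L²(Y)`. -/
def compLp (hf : AEMeasurable f m) : C(Y, 𝕜) →ₗ[𝕜] Lp 𝕜 2 m where
  toFun v := (memLp_comp hf v 2).toLp _
  map_add' _ _ := rfl
  map_smul' _ _ := rfl

theorem coeFn_compLp (hf : AEMeasurable f m) (v : C(Y, 𝕜)) :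
    compLp hf v =ᵐ[m] fun x => v (f x) :=
  (memLp_comp hf v 2).coeFn_toLp

theorem eLpNorm_comp_sub (hf : AEMeasurable f m) (v : C(Y, 𝕜)) (u : Lp 𝕜 2 m) :
    eLpNorm (fun x => v (f x) - u x) 2 m = ENNReal.ofReal ‖compLp hf v - u‖ := by
  rw [Lp.norm_def, ENNReal.ofReal_toReal (Lp.eLpNorm_ne_top _)]
  refine eLpNorm_congr_ae ?_
  filter_upwards [coeFn_compLp hf v, Lp.coeFn_sub (compLp hf v) u] with x hv hsub
  rw [hsub, Pi.sub_apply, hv]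

theorem norm_compLp_sq (hf : AEMeasurable f m) (v : C(Y, 𝕜)) :
    ‖compLp hf v‖ ^ 2 = ∫ x, ‖v (f x)‖ ^ 2 ∂m := by
  have hinner : ∫ x, inner 𝕜 (compLp hf v x) (compLp hf v x) ∂m =
      ∫ x, ((‖v (f x)‖ ^ 2 : ℝ) : 𝕜) ∂m := by
    refine integral_congr_ae ?_
    filter_upwards [coeFn_compLp hf v] with x hx
    rw [hx, inner_self_eq_norm_sq_to_K, RCLike.ofReal_pow]
  rw [@norm_sq_eq_re_inner 𝕜, L2.inner_def, hinner, integral_ofReal, RCLike.ofReal_re]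

theorem tendsto_norm_compLp {ι : Type*} {F : Filter ι} {X : ι → Type*}
    [∀ α, MeasurableSpace (X α)] {m : ∀ α, Measure (X α)} [∀ α, IsFiniteMeasure (m α)]
    {m₀ : Measure Y} [IsFiniteMeasure m₀] {f : ∀ α, X α → Y}
    (hf : ∀ α, AEMeasurable (f α) (m α))
    (hlim : ∀ g : C(Y, ℝ), Tendsto (fun α => ∫ x, g (f α x) ∂(m α)) F (𝓝 (∫ y, g y ∂m₀)))
    (v : C(Y, 𝕜)) :
    Tendsto (fun α => ‖compLp (hf α) v‖) F (𝓝 ‖compLp (m := m₀) aemeasurable_id v‖) := by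
  have hsq : Tendsto (fun α => ‖compLp (hf α) v‖ ^ 2) F
      (𝓝 (‖compLp (m := m₀) aemeasurable_id v‖ ^ 2)) := by
    simp only [norm_compLp_sq]
    exact hlim ⟨fun y => ‖v y‖ ^ 2, by fun_prop⟩
  simpa using hsq.sqrt

theorem denseRange_compLp_id {Y : Type*} [TopologicalSpace Y] [CompactSpace Y] [NormalSpace Y]
    [R1Space Y] [MeasurableSpace Y] [BorelSpace Y] (m₀ : Measure Y) [IsFiniteMeasure m₀]
    [m₀.WeaklyRegular] :
    DenseRange (compLp (𝕜 := 𝕜) (aemeasurable_id : AEMeasurable id m₀)) := by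
  convert ContinuousMap.toLp_denseRange 𝕜 m₀ 𝕜 (p := 2) (by norm_num) using 1
  exact funext fun v =>
    Lp.ext ((coeFn_compLp aemeasurable_id v).trans (ContinuousMap.coeFn_toLp m₀ v).symm)

end ContinuousFunctions

section WeakConvergence

variable {𝕜 : Type*} [RCLike 𝕜] {ι : Type*} {F : Filter ι}
  {H : Type*} [NormedAddCommGroup H] [InnerProductSpace 𝕜 H]
  {E : ι → Type*} [∀ α, NormedAddCommGroup (E α)] [∀ α, InnerProductSpace 𝕜 (E α)]
  {T : ∀ α, H →L[𝕜] E α}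

theorem WeaklyTendsto.tendsto_inner {u v : ∀ α, E α} {w z : H} {B : ℝ}
    (hu : WeaklyTendsto F T u w) (hB : ∀ α, ‖u α‖ ≤ B) (hv : StronglyTendsto F T v z) :
    Tendsto (fun α => inner 𝕜 (u α) (v α)) F (𝓝 (inner 𝕜 w z)) := by
  have herr : Tendsto (fun α => inner 𝕜 (u α) (v α - T α z)) F (𝓝 0) :=
    squeeze_zero_norm (fun α => (norm_inner_le_norm _ _).trans
      (mul_le_mul_of_nonneg_right (hB α) (norm_nonneg _))) (by simpa using Tendsto.const_mul B hv)
  simpa [← inner_add_right] using (hu z).add herr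

theorem CompactlyTendsto.neg {R : ∀ α, E α →L[𝕜] E α} {R₀ : H →L[𝕜] H}
    (hR : CompactlyTendsto F T R R₀) : CompactlyTendsto F T (fun α => -R α) (-R₀) :=
  fun u w B hB hu => by simpa using (hR u w B hB hu).const_smul (-1)

end WeakConvergence

section Transplantation

variable {𝕜 : Type*} [RCLike 𝕜] {ι : Type*} [Preorder ι] [IsDirectedOrder ι] [Nonempty ι]
  {X : ι → Type*} [∀ α, MeasurableSpace (X α)] {m : ∀ α, Measure (X α)}
  [∀ α, IsFiniteMeasure (m α)] {Y : Type*} [TopologicalSpace Y] [CompactSpace Y] [NormalSpace Y]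
  [R1Space Y] [MeasurableSpace Y] [BorelSpace Y] {m₀ : Measure Y} [IsFiniteMeasure m₀]
  [m₀.WeaklyRegular] {f : ∀ α, X α → Y} (hf : ∀ α, AEMeasurable (f α) (m α))
  {T : ∀ α, Lp 𝕜 2 m₀ →L[𝕜] Lp 𝕜 2 (m α)} (hT : IsAsymptoticIsometry atTop T)
  (hTf : ∀ v : C(Y, 𝕜), StronglyTendsto atTop T (fun α => compLp (hf α) v)
    (compLp aemeasurable_id v))
include hT hTf

theorem stronglyConverges_iff_stronglyTendsto {u : ∀ α, Lp 𝕜 2 (m α)} {w : Lp 𝕜 2 m₀} :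
    StronglyConverges f u w ↔ StronglyTendsto atTop T u w := by
  have heLp : ∀ v : C(Y, 𝕜), eLpNorm (fun y => v y - w y) 2 m₀ =
      ENNReal.ofReal ‖compLp aemeasurable_id v - w‖ := fun v =>
    eLpNorm_comp_sub aemeasurable_id v w
  simp only [StronglyConverges, heLp, eLpNorm_comp_sub (hf _)]
  constructor
  · rintro ⟨κ, _, _, _, v, hvw, hvu⟩
    refine hT.stronglyTendsto_of_forall_approx fun δ hδ => ?_
    have hδ' : 0 < ENNReal.ofReal δ := ENNReal.ofReal_pos.2 hδ
    obtain ⟨β, hw, hu⟩ := ((hvw.eventually_lt_const hδ').and (hvu.eventually_lt_const hδ')).exists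
    refine ⟨_, _, hTf (v β), (ENNReal.ofReal_lt_ofReal_iff hδ).1 hw, ?_⟩
    filter_upwards [eventually_lt_of_limsup_lt hu] with α hα
    rw [norm_sub_rev]
    exact (ENNReal.ofReal_lt_ofReal_iff hδ).1 hα
  · intro hu
    obtain ⟨x, hx, hxw⟩ := mem_closure_iff_seq_limit.1 (denseRange_compLp_id (𝕜 := 𝕜) m₀ w)
    choose v hv using hx
    have hlim : Tendsto (fun n => ENNReal.ofReal ‖compLp aemeasurable_id (v n) - w‖) atTop
        (𝓝 0) := by
      simpa [hv] using ENNReal.tendsto_ofReal (tendsto_iff_norm_sub_tendsto_zero.1 hxw)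
    have hlimsup : ∀ n, limsup (fun α => ENNReal.ofReal ‖compLp (hf α) (v n) - u α‖) atTop =
        ENNReal.ofReal ‖compLp aemeasurable_id (v n) - w‖ := fun n =>
      (ENNReal.tendsto_ofReal <| hT.tendsto_norm_of_stronglyTendsto <| by
        simpa [← sub_eq_add_neg] using (hTf (v n)).add (hu.const_smul (-1))).limsup_eq
    exact ⟨ℕ, inferInstance, inferInstance, inferInstance, v, hlim, by simpa only [hlimsup]⟩

theorem CompactlyConverges.compactlyTendsto {B : ∀ α, Lp 𝕜 2 (m α) →L[𝕜] Lp 𝕜 2 (m α)}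
    {B₀ : Lp 𝕜 2 m₀ →L[𝕜] Lp 𝕜 2 m₀} (hB : CompactlyConverges f B B₀) :
    CompactlyTendsto atTop T B B₀ := fun u w _ hC hu =>
  (stronglyConverges_iff_stronglyTendsto hf hT hTf).1 <| hB u w fun _ _ hv =>
    hu.tendsto_inner hC ((stronglyConverges_iff_stronglyTendsto hf hT hTf).1 hv)

end Transplantation

end SpectralConvergence

end

theorem mainTheorem8_general {𝕜 : Type*} [RCLike 𝕜]
    {ι : Type u} [Preorder ι] [IsDirectedOrder ι] [Nonempty ι]
    {X : ι → Type*} [∀ α, MeasurableSpace (X α)]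
    {Y : Type*} [MetricSpace Y] [CompactSpace Y] [MeasurableSpace Y] [BorelSpace Y]
    (m : ∀ α, Measure (X α)) [∀ α, IsFiniteMeasure (m α)]
    (m₀ : Measure Y) [IsFiniteMeasure m₀]
    (f : ∀ α, X α → Y) (hf : ∀ α, AEMeasurable (f α) (m α))
    (hm : ∀ g : C(Y, ℝ), Tendsto (fun α => ∫ x, g (f α x) ∂(m α)) atTop (𝓝 (∫ y, g y ∂m₀)))
    {M : ι → ℕ} (hM : Tendsto M atTop atTop)
    (S : ∀ α, SpectralConvergence.SpectralStructure 𝕜 (Lp 𝕜 2 (m α)))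
    (S₀ : SpectralConvergence.SpectralStructure 𝕜 (Lp 𝕜 2 m₀))
    (hS : SpectralConvergence.CompactlyConverges f
      (fun α => SpectralConvergence.resolvent (S α).A (-1))
      (SpectralConvergence.resolvent S₀.A (-1)))
    (hcompact : ∀ α, IsCompactOperator (SpectralConvergence.resolvent (S α).A (-1))) :
    (∀ k : ℕ, 1 ≤ k →
      Tendsto (fun α => SpectralConvergence.kthEigenvalue (S α).A k) atTop
        (𝓝 (SpectralConvergence.kthEigenvalue S₀.A k))) ∧
    ∀ φ : ∀ α, ℕ → Lp 𝕜 2 (m α),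
      (∀ α, SpectralConvergence.IsOrthonormalEigenbasis (S α).A (φ α)) →
      ∃ (κ : Type u) (_ : Preorder κ) (_ : IsDirectedOrder κ) (_ : Nonempty κ) (h : κ → ι)
        (φ₀ : ℕ → Lp 𝕜 2 m₀),
        Monotone h ∧ Tendsto h atTop atTop ∧
        SpectralConvergence.IsOrthonormalEigenbasis S₀.A φ₀ ∧
        ∀ k ∈ SpectralConvergence.dimIndices 𝕜 (Lp 𝕜 2 m₀),
          SpectralConvergence.StronglyConverges (fun b => f (h b))
            (fun b => φ (h b) k) (φ₀ k) := by
  have : Fact ((2 : ℝ≥0∞) ≠ ∞) := ⟨by norm_num⟩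
  have : SecondCountableTopology (Lp 𝕜 2 m₀) := Lp.SecondCountableTopology
  obtain ⟨T, hT, hTf⟩ := SpectralConvergence.exists_isAsymptoticIsometry hM
    (SpectralConvergence.denseRange_compLp_id (𝕜 := 𝕜) m₀)
    (SpectralConvergence.tendsto_norm_compLp hf hm)
  have hR := (hS.compactlyTendsto hf hT hTf).neg
  have hS₀ : IsCompactOperator S₀.invOneAdd := hR.isCompactOperator hT hM
  have hsub := hR.tendsto_norm_sub hT hS₀ hM
  have hlim := fun k (hk : 1 ≤ k) => SpectralConvergence.SpectralStructure.tendsto_kthEigenvalue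
    hT hS₀ (fun α => (hcompact α).neg) hsub
    (hR.tendsto_norm_sub_adjoint hT hS₀ S₀.isSymmetric_invOneAdd.isSelfAdjoint hM) hk
  refine ⟨hlim, fun φ hφ => ?_⟩
  let U := Ultrafilter.of (atTop : Filter ι)
  have hU : (U : Filter ι) ≤ atTop := Ultrafilter.of_le atTop
  obtain ⟨φ₀, hφ₀, hφ₀_lim⟩ :=
    SpectralConvergence.SpectralStructure.exists_isOrthonormalEigenbasis_stronglyTendsto
      (hT.comp_tendsto hU) hS₀ (hsub.mono_left hU) hφ fun k hk => (hlim k hk).mono_left hU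
  obtain ⟨κ, _, _, _, h, hmono, hh⟩ := SpectralConvergence.exists_monotone_tendsto_of_le_atTop hU
  have hh' := hh.mono_right hU
  refine ⟨κ, _, ‹_›, ‹_›, h, φ₀, hmono, hh', hφ₀, fun k hk => ?_⟩
  exact (SpectralConvergence.stronglyConverges_iff_stronglyTendsto (fun b => hf (h b))
    (hT.comp_tendsto hh') fun v => (hTf v).comp hh').2 ((hφ₀_lim k hk).comp hh)

theorem mainTheorem8 {𝕜 : Type*} [RCLike 𝕜]
    {ι : Type u} [Preorder ι] [IsDirectedOrder ι] [Nonempty ι]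
    {X : ι → Type*} [∀ α, MetricSpace (X α)] [∀ α, CompactSpace (X α)]
    [∀ α, MeasurableSpace (X α)] [∀ α, BorelSpace (X α)]
    {Y : Type*} [MetricSpace Y] [CompactSpace Y] [MeasurableSpace Y] [BorelSpace Y]
    (m : ∀ α, Measure (X α)) [∀ α, IsFiniteMeasure (m α)]
    (m₀ : Measure Y) [IsFiniteMeasure m₀]
    (f : ∀ α, X α → Y) (hf : SpectralConvergence.MeasuredGHConverges m m₀ f)
    (S : ∀ α, SpectralConvergence.SpectralStructure 𝕜 (Lp 𝕜 2 (m α)))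
    (S₀ : SpectralConvergence.SpectralStructure 𝕜 (Lp 𝕜 2 m₀))
    (hS : SpectralConvergence.SpectralStructure.CompactlyConverges f S S₀)
    (hcompact : ∀ α, ∀ ζ ∈ SpectralConvergence.resolventSet (S α).A,
      IsCompactOperator (SpectralConvergence.resolvent (S α).A ζ)) :
    (∀ k : ℕ, 1 ≤ k →
      Tendsto (fun α => SpectralConvergence.kthEigenvalue (S α).A k) atTop
        (𝓝 (SpectralConvergence.kthEigenvalue S₀.A k))) ∧
    ∀ φ : ∀ α, ℕ → Lp 𝕜 2 (m α),
      (∀ α, SpectralConvergence.IsOrthonormalEigenbasis (S α).A (φ α)) →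
      ∃ (κ : Type u) (_ : Preorder κ) (_ : IsDirectedOrder κ) (_ : Nonempty κ) (h : κ → ι)
        (φ₀ : ℕ → Lp 𝕜 2 m₀),
        Monotone h ∧ Tendsto h atTop atTop ∧
        SpectralConvergence.IsOrthonormalEigenbasis S₀.A φ₀ ∧
        ∀ k ∈ SpectralConvergence.dimIndices 𝕜 (Lp 𝕜 2 m₀),
          SpectralConvergence.StronglyConverges (fun b => f (h b))
            (fun b => φ (h b) k) (φ₀ k) := by
  obtain ⟨⟨ε, hε, hε₀, -⟩, hfm, hm⟩ := hf
  exact mainTheorem8_general m m₀ f hfm hm (SpectralConvergence.tendsto_natFloor_inv_atTop hε hε₀)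
    S S₀ (hS (-1) S₀.neg_one_mem_resolventSet fun α => (S α).neg_one_mem_resolventSet)
    fun α => hcompact α (-1) (S α).neg_one_mem_resolventSet
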